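/- Let $m(j)$, $j\in\mathbf Z$, be i.i.d. random variables contained almost surely in $[a_m,b_m]\subset(0,\infty)$, and let $k(j)$, $j\in\mathbf Z$, be random variables such that the $1/k(j)$ are i.i.d. and contained almost surely in $[a_k,b_k]\subset(0,\infty)$. Put $$\bar m=\mathbb E[m],\qquad \frac1{\tilde k}=\mathbb E\Big[\frac1k\Big],\qquad c=\sqrt{\tilde k/\bar m}.$$ For an integer $s\ge 0$ let $H^s_{LIL}$ be the space of functions $F:\mathbf R\to\mathbf R$ whose weak derivatives $F^{(i)}$, $0\le i\le s$, exist and satisfy $\sum_{i=0}^s\|(1+|\cdot|\log\log(|\cdot|+e))^{1/2}F^{(i)}\|_{L^2}<\infty$ (for $s\geq 1$ such functions are identified with their continuous representatives). Fix $\Phi,\Psi\in H^3_{LIL}$ and $T_0>0$, and set $$A=\tfrac12\Phi-\tfrac{\sqrt{\tilde k\bar m}}2\Psi,\qquad B=\tfrac12\Phi+\tfrac{\sqrt{\tilde k\bar m}}2\Psi,$$ $$Q_0(X,\tau)=A(X-c\tau)+B(X+c\tau),\qquad P_0(X,\tau)=\frac1{\sqrt{\tilde k\bar m}}\big(-A(X-c\tau)+B(X+c\tau)\big).$$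 For $\epsilon\in(0,1/2)$ let $(r,p)$ (which depends on $\epsilon$) be the $\ell^2(\mathbf Z)\times \ell^2(\mathbf Z)$-valued solution on $t\in\mathbf R$ of $$\dot r(j)=p(j+1)-p(j),\qquad \dot p(j)=\frac1{m(j)}\big(k(j)r(j)-k(j-1)r(j-1)\big)$$ with initial data $r(j,0)=\Phi(\epsilon j)/k(j)$ and $p(j,0)=\Psi(\epsilon j)$. Then, almost surely, the following hold. 1. If for every $\tau\in[-T_0,T_0]$ the function $Q_0(\cdot,\tau)$ is not identically zero, then $$\lim_{\epsilon\to0^+}\ \sup_{|t|\le T_0/\epsilon}\frac{\big\|r(\cdot,t)-\frac1{k(\cdot)}\big(A(\epsilon(\cdot-ct))+B(\epsilon(\cdot+ct))\big)\big\|_{\ell^2}}{\|r(t)\|_{\ell^2}}=0.$$ 2. If for every $\tau\in[-T_0,T_0]$ the function $P_0(\cdot,\tau)$ is not identically zero, then $$\lim_{\epsilon\to0^+}\ \sup_{|t|\le T_0/\epsilon}\frac{\big\|p(\cdot,t)-\frac1{\sqrt{\tilde k\bar m}}\big(-A(\epsilon(\cdot-ct))+B(\epsilon(\cdot+ct))\big)\big\|_{\ell^2}}{\|p(t)\|_{\ell^2}}=0.$$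 -/

import Mathlib

open Set Filter Topology MeasureTheory ProbabilityTheory

open scoped ENNReal

noncomputable section

namespace RandomLattice

/-- The Hilbert space `ℓ²(ℤ)` of real square summable doubly infinite sequences. -/
abbrev EllTwo : Type := lp (fun _ : ℤ => ℝ) 2

/-- The `ℓ²` norm of an arbitrary doubly infinite sequence, with values in `[0, ∞]`:
the `L²` norm for the counting measure on `ℤ`. -/
def ellTwoNorm (f : ℤ → ℝ) : ℝ≥0∞ := eLpNorm f 2 Measure.count

/-- `(δ⁺ f)(j) = f(j+1) - f(j)`. -/
def deltaPlus (f : ℤ → ℝ) (j : ℤ) : ℝ := f (j + 1) - f j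

/-- `(δ⁻ f)(j) = f(j) - f(j-1)`. -/
def deltaMinus (f : ℤ → ℝ) (j : ℤ) : ℝ := f j - f (j - 1)

/-- `(r, p)` is an `ℓ²`-valued solution, for all times `t ∈ ℝ`, of the lattice system
`ṙ = δ⁺ p`, `ṗ = (1/m) δ⁻ (k r)` with masses `m(j)` and spring coefficients `k(j)`. -/
structure IsLatticeSolution (m k : ℤ → ℝ) (r p : ℝ → EllTwo) : Prop where
  differentiable_r : Differentiable ℝ r
  differentiable_p : Differentiable ℝ p
  deriv_r : ∀ (t : ℝ) (j : ℤ), deriv r t j = deltaPlus (p t) j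
  deriv_p : ∀ (t : ℝ) (j : ℤ), deriv p t j = 1 / m j * deltaMinus (fun i => k i * r t i) j

/-- `G` is the weak derivative of order `i` of `F` on `ℝ`, tested against `C_c^∞(ℝ)`. -/
def IsWeakDeriv (i : ℕ) (F G : ℝ → ℝ) : Prop :=
  LocallyIntegrable F ∧ LocallyIntegrable G ∧
    ∀ φ : ℝ → ℝ, ContDiff ℝ ((⊤ : ℕ∞) : WithTop ℕ∞) φ → HasCompactSupport φ →
      ∫ x, F x * iteratedDeriv i φ x = (-1) ^ i * ∫ x, G x * φ x

/-- The weight `(1 + |x| log log (|x| + e))^{1/2}`. -/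
def lilWeight (x : ℝ) : ℝ :=
  Real.sqrt (1 + |x| * Real.log (Real.log (|x| + Real.exp 1)))

/-- `F` is (the continuous representative of) an element of the weighted Sobolev space
`H^s_LIL(ℝ)`: its weak derivatives up to order `s` exist and are square integrable against
the weight, that is, `∑_{i ≤ s} ‖lilWeight · F^{(i)}‖_{L²} < ∞`. The continuous
representative (it exists and is unique for `s ≥ 1`) is the one that can be sampled at points. -/
def MemHLIL (s : ℕ) (F : ℝ → ℝ) : Prop :=
  Continuous F ∧
    ∀ i ≤ s, ∃ G : ℝ → ℝ, IsWeakDeriv i F G ∧ MemLp (fun x => lilWeight x * G x) 2 volume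

/-- The random variables `X(j)`, `j ∈ ℤ`, are independent and identically distributed and
almost surely contained in `[a, b]`. -/
structure IsIIDIn {Ω : Type*} [MeasurableSpace Ω] (μ : Measure Ω) (X : ℤ → Ω → ℝ)
    (a b : ℝ) : Prop where
  indep : iIndepFun X μ
  identDistrib : ∀ j, IdentDistrib (X j) (X 0) μ μ
  mem_Icc : ∀ j, ∀ᵐ ω ∂μ, X j ω ∈ Icc a b

/-- `m̄ = 𝔼[m]`. -/
def meanMass {Ω : Type*} [MeasurableSpace Ω] (μ : Measure Ω) (m : ℤ → Ω → ℝ) : ℝ :=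
  ∫ ω, m 0 ω ∂μ

/-- `k̃`, defined by `1 / k̃ = 𝔼[1 / k]`. -/
def effSpring {Ω : Type*} [MeasurableSpace Ω] (μ : Measure Ω) (k : ℤ → Ω → ℝ) : ℝ :=
  1 / ∫ ω, 1 / k 0 ω ∂μ

/-- The wave speed `c = √(k̃ / m̄)`, as a function of `k̃` and `m̄`. -/
def waveSpeed (kt mb : ℝ) : ℝ := Real.sqrt (kt / mb)

/-- `A(X) = Φ(X)/2 - (√(k̃ m̄)/2) Ψ(X)`. -/
def profileA (kt mb : ℝ) (Φ Ψ : ℝ → ℝ) (X : ℝ) : ℝ :=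
  1 / 2 * Φ X - Real.sqrt (kt * mb) / 2 * Ψ X

/-- `B(X) = Φ(X)/2 + (√(k̃ m̄)/2) Ψ(X)`. -/
def profileB (kt mb : ℝ) (Φ Ψ : ℝ → ℝ) (X : ℝ) : ℝ :=
  1 / 2 * Φ X + Real.sqrt (kt * mb) / 2 * Ψ X

/-- The effective wave `Q₀(X, τ) = A(X - cτ) + B(X + cτ)`. -/
def waveQ (kt mb : ℝ) (Φ Ψ : ℝ → ℝ) (X τ : ℝ) : ℝ :=
  profileA kt mb Φ Ψ (X - waveSpeed kt mb * τ) + profileB kt mb Φ Ψ (X + waveSpeed kt mb * τ)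

/-- The effective wave `P₀(X, τ) = (-A(X - cτ) + B(X + cτ)) / √(k̃ m̄)`. -/
def waveP (kt mb : ℝ) (Φ Ψ : ℝ → ℝ) (X τ : ℝ) : ℝ :=
  1 / Real.sqrt (kt * mb) *
    (-profileA kt mb Φ Ψ (X - waveSpeed kt mb * τ) +
      profileB kt mb Φ Ψ (X + waveSpeed kt mb * τ))

/-- `sup_{|t| ≤ T} ‖f(t) - g(t)‖_{ℓ²} / ‖f(t)‖_{ℓ²}`, computed in `[0, ∞]`. -/
def supRelError (T : ℝ) (f g : ℝ → ℤ → ℝ) : ℝ≥0∞ :=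
  ⨆ t ∈ Icc (-T) T, ellTwoNorm (f t - g t) / ellTwoNorm (f t)

end RandomLattice

end

/-!
The lattice system `ṙ = δ⁺ p`, `m ṗ = δ⁻ (k r)` conserves the energy `∑ (k r² + m p²)`, and the
`ℓ²` size of the solution and of the effective wave is of order `ε^{-1/2}`. It is therefore enough
to show that the two differ by `o(ε^{-1/2})` in `ℓ²`, uniformly for `|t| ≤ T₀ / ε`. As no rate of
convergence is asked for, density and the strong law of large numbers suffice, and the logarithmic
weight is used only through the bound `1 ≤ lilWeight`.

* Truncation. Functions in the weighted `H³` are `C²` with `F, F' ∈ L²`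
  (`MemHLIL.regularity`, by the du Bois-Reymond lemma). Sampling on the grid `ε ℤ + s` is bounded
  by `ε^{-1/2}` times the `H¹` norm (`ellTwoNorm_sample_le`), so the profiles `A` and `B` may be
  replaced by compactly supported `C²` ones (`exists_compactSupport_sample_approx`).

* Correctors. For one travelling profile `f(ε (j + σ t))` the random coefficients leave residuals
  `ε (1 / k - 1 / k̃) σ f'` and `ε (m - m̄) f' / m̄`, too large to be integrated up to time `T₀ / ε`.
  Writing the fluctuations as differences `δ⁺ χₖ` and `δ⁻ χₘ` and adding `ε σ χₖ f'` and
  `ε χₘ f' / m̄` to the ansatz leaves residuals `O(ε² (1 + |χ|))` on the support, where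
  `|j| = O(1 / ε)`. The strong law gives `χ(j) = o(|j|)` almost surely
  (`IsIIDIn.ae_exists_sublinear_primitive`), hence residuals of `ℓ²` norm `o(ε^{1/2})` and a
  corrector of norm `o(ε^{-1/2})` (`exists_approximate_wave`).

* Energy. The difference between the lattice solution and the corrected truncated wave is
  controlled by its initial value plus `T₀ / ε` times the residual (`norm_le_of_residual`), which
  gives `eventually_error_le`.

* Relative error. By continuity and compactness of `[-T₀, T₀]`, a wave that vanishes identically at
  no time has sampled norm at least `κ ε^{-1/2}` (`exists_le_ellTwoNorm_sample`), so the relative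
  error tends to zero (`tendsto_supRelError`).
-/

namespace RandomLattice

/-! ### Norms of square summable sequences -/

theorem ellTwoNorm_sq (f : ℤ → ℝ) : ellTwoNorm f ^ 2 = ∑' j, ‖f j‖ₑ ^ 2 := by
  rw [ellTwoNorm, eLpNorm_eq_lintegral_rpow_enorm_toReal (by norm_num) (by norm_num),
    lintegral_count, ← ENNReal.rpow_natCast, ← ENNReal.rpow_mul]
  norm_num

theorem ellTwoNorm_coe (f : EllTwo) : ellTwoNorm f = ENNReal.ofReal ‖f‖ := by
  have h : ellTwoNorm f ^ 2 = ENNReal.ofReal ‖f‖ ^ 2 := by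
    have hs := lp.hasSum_norm (p := 2) (by norm_num) f
    norm_num at hs
    rw [ellTwoNorm_sq, ← ENNReal.ofReal_pow (norm_nonneg _), ← hs.tsum_eq,
      ENNReal.ofReal_tsum_of_nonneg (fun _ => sq_nonneg _) hs.summable]
    refine tsum_congr fun j => ?_
    rw [← ofReal_norm, ← ENNReal.ofReal_pow (norm_nonneg _), Real.norm_eq_abs, sq_abs]
  exact (ENNReal.pow_right_strictMono two_ne_zero).injective h

theorem ellTwoNorm_add_le (f g : ℤ → ℝ) : ellTwoNorm (f + g) ≤ ellTwoNorm f + ellTwoNorm g :=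
  eLpNorm_add_le (measurable_of_countable f).aestronglyMeasurable
    (measurable_of_countable g).aestronglyMeasurable (by norm_num)

theorem ellTwoNorm_neg (f : ℤ → ℝ) : ellTwoNorm (-f) = ellTwoNorm f := eLpNorm_neg _ _ _

theorem ellTwoNorm_sub_le (f g : ℤ → ℝ) : ellTwoNorm (f - g) ≤ ellTwoNorm f + ellTwoNorm g := by
  rw [sub_eq_add_neg, ← ellTwoNorm_neg g]; exact ellTwoNorm_add_le _ _

theorem ellTwoNorm_mono {f g : ℤ → ℝ} (h : ∀ j, |f j| ≤ |g j|) : ellTwoNorm f ≤ ellTwoNorm g :=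
  eLpNorm_mono h

theorem ellTwoNorm_mul_le {w : ℤ → ℝ} {C : ℝ} (f : ℤ → ℝ) (h : ∀ j, |w j| ≤ C) :
    ellTwoNorm (fun j => w j * f j) ≤ ENNReal.ofReal C * ellTwoNorm f :=
  eLpNorm_le_mul_eLpNorm_of_ae_le_mul (Eventually.of_forall fun j => by
    rw [norm_mul]; exact mul_le_mul_of_nonneg_right (h j) (norm_nonneg _)) 2

theorem ellTwoNorm_le_of_add {f g h : ℤ → ℝ} {a b : ℝ} (ha : 0 ≤ a) (hb : 0 ≤ b)
    (hg : ellTwoNorm g ≤ ENNReal.ofReal a) (hh : ellTwoNorm h ≤ ENNReal.ofReal b)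
    (hf : ∀ j, f j = g j + h j) : ellTwoNorm f ≤ ENNReal.ofReal (a + b) := by
  have : f = g + h := funext hf
  rw [this, ENNReal.ofReal_add ha hb]
  exact (ellTwoNorm_add_le _ _).trans (add_le_add hg hh)

theorem ellTwoNorm_le_of_mul {f g w : ℤ → ℝ} {a C : ℝ} (hC : 0 ≤ C)
    (hg : ellTwoNorm g ≤ ENNReal.ofReal a) (hw : ∀ j, |w j| ≤ C)
    (hf : ∀ j, f j = w j * g j) : ellTwoNorm f ≤ ENNReal.ofReal (C * a) := by
  have : f = fun j => w j * g j := funext hf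
  rw [this, ENNReal.ofReal_mul hC]
  exact (ellTwoNorm_mul_le _ hw).trans (by gcongr)

/-- A sequence supported in `[-N, N]` and bounded by `M` has `ℓ²` norm at most `M √(2N+1)`. -/
theorem ellTwoNorm_le_of_support {f : ℤ → ℝ} {M : ℝ} {N : ℕ} (hM : 0 ≤ M)
    (hf : ∀ j, |f j| ≤ M) (hs : ∀ j, (N : ℤ) < |j| → f j = 0) :
    ellTwoNorm f ≤ ENNReal.ofReal (Real.sqrt (2 * N + 1) * M) := by
  have h : ellTwoNorm f ^ 2 ≤ ENNReal.ofReal (Real.sqrt (2 * N + 1) * M) ^ 2 := by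
    rw [ellTwoNorm_sq, tsum_eq_sum (s := Finset.Icc (-(N : ℤ)) N),
      ← ENNReal.ofReal_pow (by positivity)]
    · calc ∑ j ∈ Finset.Icc (-(N : ℤ)) N, ‖f j‖ₑ ^ 2
          ≤ ∑ j ∈ Finset.Icc (-(N : ℤ)) N, ENNReal.ofReal (M ^ 2) := by
            refine Finset.sum_le_sum fun j _ => ?_
            rw [← ofReal_norm, ← ENNReal.ofReal_pow (norm_nonneg _)]
            exact ENNReal.ofReal_le_ofReal (pow_le_pow_left₀ (norm_nonneg _) (hf j) 2)
        _ = ENNReal.ofReal ((Real.sqrt (2 * N + 1) * M) ^ 2) := by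
            rw [Finset.sum_const, Int.card_Icc, mul_pow, Real.sq_sqrt (by positivity),
              ENNReal.ofReal_mul (by positivity), nsmul_eq_mul]
            congr 1
            rw [show ((N : ℤ) + 1 - -(N : ℤ)).toNat = 2 * N + 1 by omega, ← ENNReal.ofReal_natCast]
            push_cast
            rfl
    · intro j hj
      rw [hs j]
      · simp
      · by_contra hc
        exact hj (Finset.mem_Icc.2 (abs_le.1 (not_lt.1 hc)))
  exact (ENNReal.pow_right_strictMono two_ne_zero).le_iff_le.1 h

/-- A sequence with finite `ℓ²` norm, here a residual given coordinatewise, is an element of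
`ℓ²(ℤ)`. -/
theorem exists_ellTwo_of_ellTwoNorm_le {f : ℤ → ℝ} {C : ℝ} (hC : 0 ≤ C)
    (hf : ellTwoNorm f ≤ ENNReal.ofReal C) : ∃ g : EllTwo, (∀ j, g j = f j) ∧ ‖g‖ ≤ C := by
  have h1 : ∑' j, ‖f j‖ₑ ^ 2 ≠ ⊤ := by
    rw [← ellTwoNorm_sq]
    exact ENNReal.pow_ne_top (ne_top_of_le_ne_top ENNReal.ofReal_ne_top hf)
  have h2 : Memℓp f 2 := by
    refine memℓp_gen ((ENNReal.summable_toReal h1).congr fun j => ?_)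
    rw [ENNReal.toReal_pow, toReal_enorm]
    norm_num
  refine ⟨⟨f, h2⟩, fun j => rfl, ?_⟩
  have h3 := ellTwoNorm_coe ⟨f, h2⟩
  rw [← ENNReal.ofReal_le_ofReal_iff hC, ← h3]
  exact hf

/-! ### The energy estimate -/

/-- Multiplication by a bounded sequence `w`, as a bounded operator on `ℓ²(ℤ)`. -/
noncomputable def diag (w : ℤ → ℝ) (C : ℝ) (hC : 0 ≤ C) (hw : ∀ j, |w j| ≤ C) :
    EllTwo →L[ℝ] EllTwo :=
  LinearMap.mkContinuous
    { toFun := fun f => ⟨fun j => w j * f j,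
        ((lp.memℓp f).norm.const_mul C).mono fun j => by
          rw [norm_mul]
          exact mul_le_mul_of_nonneg_right (hw j) (norm_nonneg _)⟩
      map_add' := fun f g => by ext j; exact mul_add _ _ _
      map_smul' := fun a f => by ext j; exact mul_left_comm _ _ _ }
    C fun f => by
      have h : C * ‖f‖ = ‖C • f‖ := by rw [norm_smul, Real.norm_of_nonneg hC]
      rw [h]
      refine lp.norm_mono two_ne_zero fun j => ?_
      change ‖w j * f j‖ ≤ ‖C * f j‖
      rw [norm_mul, norm_mul, Real.norm_of_nonneg hC]
      exact mul_le_mul_of_nonneg_right (hw j) (norm_nonneg _)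

theorem diag_apply {w : ℤ → ℝ} {C : ℝ} (hC : 0 ≤ C) (hw : ∀ j, |w j| ≤ C) (f : EllTwo) (j : ℤ) :
    diag w C hC hw f j = w j * f j := rfl

theorem norm_diag_le {w : ℤ → ℝ} {C : ℝ} (hC : 0 ≤ C) (hw : ∀ j, |w j| ≤ C) (f : EllTwo) :
    ‖diag w C hC hw f‖ ≤ C * ‖f‖ :=
  ((diag w C hC hw).le_opNorm f).trans
    (mul_le_mul_of_nonneg_right (LinearMap.mkContinuous_norm_le _ hC _) (norm_nonneg _))

/-- A positive weight bounded below makes the quadratic form `∑ w(j) f(j)²` coercive. -/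
theorem le_inner_diag {w : ℤ → ℝ} {c C : ℝ} (hC : 0 ≤ C) (hw : ∀ j, |w j| ≤ C)
    (hc : ∀ j, c ≤ w j) (f : EllTwo) : c * ‖f‖ ^ 2 ≤ inner ℝ (diag w C hC hw f) f := by
  rw [← real_inner_self_eq_norm_sq]
  refine hasSum_le (fun j => ?_) ((lp.hasSum_inner (𝕜 := ℝ) f f).mul_left c)
    (lp.hasSum_inner (𝕜 := ℝ) _ f)
  rw [diag_apply]
  simp only [RCLike.inner_apply, conj_trivial]
  nlinarith [hc j, mul_self_nonneg (f j)]

theorem inner_diag_comm {w : ℤ → ℝ} {C : ℝ} (hC : 0 ≤ C) (hw : ∀ j, |w j| ≤ C)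
    (f g : EllTwo) : inner ℝ (diag w C hC hw f) g = inner ℝ f (diag w C hC hw g) := by
  rw [lp.inner_eq_tsum, lp.inner_eq_tsum]
  refine tsum_congr fun j => ?_
  rw [diag_apply, diag_apply]
  simp only [RCLike.inner_apply, conj_trivial]
  ring

/-- Summation by parts: `δ⁺` and `-δ⁻` are adjoint, so the coupling terms of the lattice system
do not contribute to the time derivative of the energy. -/
theorem inner_add_inner_eq_of_delta {x y u v : EllTwo} {ρ₁ ρ₂ : EllTwo}
    (hu : ∀ j, u j = deltaPlus y j + ρ₁ j) (hv : ∀ j, v j = deltaMinus x j + ρ₂ j) :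
    inner ℝ x u + inner ℝ y v = inner ℝ x ρ₁ + inner ℝ y ρ₂ := by
  have h1 := (lp.hasSum_inner (𝕜 := ℝ) x (u - ρ₁)).add (lp.hasSum_inner (𝕜 := ℝ) y (v - ρ₂))
  rw [inner_sub_right, inner_sub_right] at h1
  have hs : Summable fun j : ℤ => x (j - 1) * y j := by
    have h2 := (lp.hasSum_inner (𝕜 := ℝ) x (u - ρ₁)).add (lp.hasSum_inner (𝕜 := ℝ) x y)
    have h3 := (Equiv.subRight (1 : ℤ)).summable_iff.2 h2.summable
    refine h3.congr fun j => ?_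
    simp only [Function.comp, Equiv.subRight_apply, RCLike.inner_apply, conj_trivial,
      lp.coeFn_sub, Pi.sub_apply, hu, deltaPlus, sub_add_cancel]
    ring
  have h4 : HasSum (fun j : ℤ => x j * y (j + 1) - x (j - 1) * y j) 0 := by
    have h5 := (Equiv.addRight (1 : ℤ)).hasSum_iff.2 hs.hasSum
    have h6 := h5.sub hs.hasSum
    rw [sub_self] at h6
    refine h6.congr_fun fun j => ?_
    simp
  have h7 := h1.unique (h4.congr_fun fun j => by
    simp only [RCLike.inner_apply, conj_trivial, lp.coeFn_sub, Pi.sub_apply, hu, hv, deltaPlus,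
      deltaMinus]
    ring)
  linarith

/-- Energy estimate: if `(R, P)` solves the lattice system up to residuals of size `ρ` on
`[-T, T]`, its norm there is controlled by its initial value and by `ρ T`. The constant depends
only on the bounds for the coefficients. -/
theorem norm_le_of_residual {m k : ℤ → ℝ} {c C : ℝ} (hc : 0 < c)
    (hm : ∀ j, m j ∈ Icc c C) (hk : ∀ j, k j ∈ Icc c C) :
    ∃ D : ℝ, 0 < D ∧ ∀ (R P R' P' : ℝ → EllTwo) (T ρ : ℝ), 0 ≤ T → 0 ≤ ρ →
      (∀ t, HasDerivAt R (R' t) t) → (∀ t, HasDerivAt P (P' t) t) →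
      (∀ t ∈ Icc (-T) T, ellTwoNorm (fun j => R' t j - deltaPlus (P t) j) ≤ ENNReal.ofReal ρ) →
      (∀ t ∈ Icc (-T) T, ellTwoNorm (fun j => m j * P' t j - deltaMinus (fun i => k i * R t i) j)
        ≤ ENNReal.ofReal ρ) →
      ∀ t ∈ Icc (-T) T, ‖R t‖ ≤ D * (‖R 0‖ + ‖P 0‖ + ρ * T) ∧
        ‖P t‖ ≤ D * (‖R 0‖ + ‖P 0‖ + ρ * T) := by
  have hC : 0 ≤ C := hc.le.trans ((hm 0).1.trans (hm 0).2)
  have hm' : ∀ j, |m j| ≤ C := fun j =>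
    abs_le.2 ⟨by linarith [(hm j).1], (hm j).2⟩
  have hk' : ∀ j, |k j| ≤ C := fun j =>
    abs_le.2 ⟨by linarith [(hk j).1], (hk j).2⟩
  set K := diag k C hC hk'
  set M := diag m C hC hm'
  set s := Real.sqrt c
  have hs : 0 < s := Real.sqrt_pos.2 hc
  have hss : s ^ 2 = c := Real.sq_sqrt hc.le
  set q := Real.sqrt C
  have hqq : q ^ 2 = C := Real.sq_sqrt hC
  have hq : 0 ≤ q := Real.sqrt_nonneg _
  refine ⟨(q + (C + 1) / s + 1) / s, by positivity, ?_⟩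
  intro R P R' P' T ρ hT hρ hR hP h1 h2
  set E : ℝ → ℝ := fun t => inner ℝ (K (R t)) (R t) + inner ℝ (M (P t)) (P t)
  have hE_lower : ∀ t, c * ‖R t‖ ^ 2 + c * ‖P t‖ ^ 2 ≤ E t := fun t =>
    add_le_add (le_inner_diag hC hk' (fun j => (hk j).1) _)
      (le_inner_diag hC hm' (fun j => (hm j).1) _)
  have hE_upper : ∀ t, E t ≤ (q * (‖R t‖ + ‖P t‖)) ^ 2 := fun t => by
    have e1 := (real_inner_le_norm (K (R t)) (R t)).trans
      (mul_le_mul_of_nonneg_right (norm_diag_le hC hk' (R t)) (norm_nonneg _))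
    have e2 := (real_inner_le_norm (M (P t)) (P t)).trans
      (mul_le_mul_of_nonneg_right (norm_diag_le hC hm' (P t)) (norm_nonneg _))
    have e3 : 0 ≤ C * (‖R t‖ * ‖P t‖) := by positivity
    rw [mul_pow, hqq]
    change _ + _ ≤ _
    nlinarith
  have hE_deriv : ∀ t, HasDerivAt E
      (2 * (inner ℝ (K (R t)) (R' t) + inner ℝ (P t) (M (P' t)))) t := by
    intro t
    have e1 := ((K.hasFDerivAt.comp_hasDerivAt t (hR t)).inner ℝ (hR t)).add
      ((M.hasFDerivAt.comp_hasDerivAt t (hP t)).inner ℝ (hP t))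
    refine e1.congr_deriv ?_
    change inner ℝ (K (R t)) (R' t) + inner ℝ (K (R' t)) (R t) +
      (inner ℝ (M (P t)) (P' t) + inner ℝ (M (P' t)) (P t)) = _
    rw [inner_diag_comm hC hk' (R' t), inner_diag_comm hC hm' (P t), real_inner_comm _ (R' t),
      real_inner_comm (P t) (M (P' t))]
    ring
  have hE_deriv_le : ∀ t ∈ Icc (-T) T,
      |inner ℝ (K (R t)) (R' t) + inner ℝ (P t) (M (P' t))| ≤ ρ * (C * ‖R t‖ + ‖P t‖) := by
    intro t ht
    obtain ⟨ρ₁, e1, n1⟩ := exists_ellTwo_of_ellTwoNorm_le hρ (h1 t ht)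
    obtain ⟨ρ₂, e2, n2⟩ := exists_ellTwo_of_ellTwoNorm_le hρ (h2 t ht)
    rw [inner_add_inner_eq_of_delta (ρ₁ := ρ₁) (ρ₂ := ρ₂)]
    · have i1 := (abs_real_inner_le_norm (K (R t)) ρ₁).trans
        (mul_le_mul (norm_diag_le hC hk' (R t)) n1 (norm_nonneg _) (by positivity))
      have i2 := (abs_real_inner_le_norm (P t) ρ₂).trans
        (mul_le_mul_of_nonneg_left n2 (norm_nonneg _))
      refine (abs_add_le _ _).trans ?_
      linarith
    · intro j; rw [e1]; ring
    · intro j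
      rw [e2, show M (P' t) j = m j * P' t j from rfl]
      have : deltaMinus (fun i => k i * R t i) j = deltaMinus (K (R t)) j := rfl
      rw [this]; ring
  -- The square root of the energy is Lipschitz; a positive `δ` keeps it differentiable.
  suffices H : ∀ δ > 0, ∀ t ∈ Icc (-T) T,
      Real.sqrt (E t + δ ^ 2) ≤ (q + (C + 1) / s + 1) * (‖R 0‖ + ‖P 0‖ + ρ * T) + δ by
    intro t ht
    have hb : ∀ x : ℝ, 0 ≤ x → c * x ^ 2 ≤ E t →
        x ≤ (q + (C + 1) / s + 1) / s * (‖R 0‖ + ‖P 0‖ + ρ * T) := by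
      intro x hx hxE
      rw [div_mul_eq_mul_div, le_div_iff₀ hs]
      refine le_of_forall_pos_le_add fun δ hδ => ?_
      refine le_trans (Real.le_sqrt_of_sq_le ?_) (H δ hδ t ht)
      rw [mul_pow, hss]
      nlinarith [sq_nonneg δ]
    exact ⟨hb _ (norm_nonneg _) (by nlinarith [hE_lower t, sq_nonneg ‖P t‖]),
      hb _ (norm_nonneg _) (by nlinarith [hE_lower t, sq_nonneg ‖R t‖])⟩
  intro δ hδ
  set g : ℝ → ℝ := fun t => Real.sqrt (E t + δ ^ 2)
  have hEn : ∀ t, 0 ≤ E t := fun t => le_trans (by positivity) (hE_lower t)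
  have hg0 : ∀ t, 0 < E t + δ ^ 2 := fun t => by have := hEn t; positivity
  have hg : ∀ t, 0 < g t := fun t => Real.sqrt_pos.2 (hg0 t)
  have hgb : ∀ t, ∀ x : ℝ, 0 ≤ x → c * x ^ 2 ≤ E t → x ≤ g t / s := by
    intro t x hx hxE
    rw [le_div_iff₀ hs]
    refine Real.le_sqrt_of_sq_le ?_
    rw [mul_pow, hss]
    nlinarith [sq_nonneg δ]
  have hg' : ∀ t ∈ Icc (-T) T, HasDerivWithinAt g
      (2 * (inner ℝ (K (R t)) (R' t) + inner ℝ (P t) (M (P' t))) / (2 * g t)) (Icc (-T) T) t :=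
    fun t _ => (((hE_deriv t).add_const (δ ^ 2)).sqrt (hg0 t).ne').hasDerivWithinAt
  have hg'' : ∀ t ∈ Icc (-T) T,
      ‖2 * (inner ℝ (K (R t)) (R' t) + inner ℝ (P t) (M (P' t))) / (2 * g t)‖
        ≤ ρ * ((C + 1) / s) := by
    intro t ht
    rw [mul_div_mul_left _ _ two_ne_zero, norm_div, Real.norm_of_nonneg (hg t).le,
      div_le_iff₀ (hg t), Real.norm_eq_abs]
    refine (hE_deriv_le t ht).trans ?_
    have a1 := hgb t _ (norm_nonneg (R t)) (by nlinarith [hE_lower t, sq_nonneg ‖P t‖])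
    have a2 := hgb t _ (norm_nonneg (P t)) (by nlinarith [hE_lower t, sq_nonneg ‖R t‖])
    have a3 : C * ‖R t‖ + ‖P t‖ ≤ (C + 1) * (g t / s) := by nlinarith
    calc ρ * (C * ‖R t‖ + ‖P t‖) ≤ ρ * ((C + 1) * (g t / s)) := by gcongr
      _ = ρ * ((C + 1) / s) * g t := by ring
  intro t ht
  have h0 : (0 : ℝ) ∈ Icc (-T) T := ⟨by linarith, hT⟩
  have hlip := (convex_Icc (-T) T).norm_image_sub_le_of_norm_hasDerivWithin_le hg' hg'' h0 ht
  have hg00 : g 0 ≤ q * (‖R 0‖ + ‖P 0‖) + δ := by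
    refine Real.sqrt_le_iff.2 ⟨by positivity, ?_⟩
    have : 0 ≤ q * (‖R 0‖ + ‖P 0‖) * δ := by positivity
    nlinarith [hE_upper 0]
  have ht' : ‖t - 0‖ ≤ T := by rw [sub_zero]; exact abs_le.2 ht
  have hl2 : g t - g 0 ≤ ρ * ((C + 1) / s) * T :=
    (le_abs_self _).trans (hlip.trans (mul_le_mul_of_nonneg_left ht' (by positivity)))
  have p1 : 0 ≤ (C + 1) / s := by positivity
  have p2 : 0 ≤ ρ * T := by positivity
  have p3 : 0 ≤ ‖R 0‖ + ‖P 0‖ := by positivity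
  change g t ≤ _
  nlinarith [mul_nonneg p1 p3, mul_nonneg hq p2]

/-! ### Corrected travelling waves -/

/-- A finitely supported family of differentiable functions is differentiable as a curve in
`ℓ²(ℤ)`. -/
theorem exists_hasDerivAt_ellTwo {a a' : ℝ → ℤ → ℝ} (S : Finset ℤ)
    (h : ∀ t j, HasDerivAt (fun t => a t j) (a' t j) t) :
    ∃ R R' : ℝ → EllTwo, (∀ t, HasDerivAt R (R' t) t) ∧
      (∀ t j, R t j = if j ∈ S then a t j else 0) ∧
      (∀ t j, R' t j = if j ∈ S then a' t j else 0) := by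
  classical
  have key : ∀ (b : ℤ → ℝ) (j : ℤ),
      (∑ i ∈ S, lp.singleContinuousLinearMap ℝ (fun _ : ℤ => ℝ) 2 i (b i) : EllTwo) j =
        if j ∈ S then b j else 0 := by
    intro b j
    rw [lp.coeFn_sum, Finset.sum_apply]
    simp [lp.single_apply, Pi.single_apply]
  refine ⟨fun t => ∑ i ∈ S, lp.singleContinuousLinearMap ℝ (fun _ : ℤ => ℝ) 2 i (a t i),
    fun t => ∑ i ∈ S, lp.singleContinuousLinearMap ℝ (fun _ : ℤ => ℝ) 2 i (a' t i),
    fun t => ?_, fun t j => key _ j, fun t j => key _ j⟩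
  exact HasDerivAt.fun_sum fun i _ =>
    (lp.singleContinuousLinearMap ℝ (fun _ : ℤ => ℝ) 2 i).hasFDerivAt.comp_hasDerivAt t (h t i)

/-- `χ(j) = o(|j|)` as `|j| → ∞`. -/
def Sublinear (χ : ℤ → ℝ) : Prop :=
  ∀ η > 0, ∃ C : ℝ, ∀ j : ℤ, |χ j| ≤ η * |(j : ℝ)| + C

theorem Sublinear.eventually_mul_le {χ : ℤ → ℝ} (hχ : Sublinear χ) {L β : ℝ} (hL : 0 ≤ L)
    (hβ : 0 < β) :
    ∀ᶠ ε : ℝ in 𝓝[>] 0, ∀ j : ℤ, ε * |(j : ℝ)| ≤ L → ε * |χ j| ≤ β := by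
  obtain ⟨C, hC⟩ := hχ (β / (2 * (L + 1))) (by positivity)
  have h1 : ∀ᶠ ε : ℝ in 𝓝[>] 0, ε * C < β / 2 := by
    have : Tendsto (fun ε : ℝ => ε * C) (𝓝[>] 0) (𝓝 (0 * C)) :=
      (tendsto_id.mono_left nhdsWithin_le_nhds).mul_const C
    rw [zero_mul] at this
    exact this.eventually_lt_const (by positivity)
  filter_upwards [h1, self_mem_nhdsWithin] with ε h1 hε j hj
  have hε : 0 < ε := hε
  calc ε * |χ j| ≤ ε * (β / (2 * (L + 1)) * |(j : ℝ)| + C) := by gcongr; exact hC j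
    _ = β / (2 * (L + 1)) * (ε * |(j : ℝ)|) + ε * C := by ring
    _ ≤ β / (2 * (L + 1)) * (L + 1) + β / 2 := by gcongr; linarith
    _ = β := by field_simp; ring

/-- Uniform bounds for a compactly supported `C²` profile, with first order Taylor estimates. -/
theorem exists_profile_bounds {f : ℝ → ℝ} (hf : ContDiff ℝ 2 f) (hc : HasCompactSupport f) :
    (∀ x, HasDerivAt f (deriv f x) x) ∧ (∀ x, HasDerivAt (deriv f) (deriv (deriv f) x) x) ∧
    ∃ M L : ℝ, 0 ≤ M ∧ 0 ≤ L ∧ (∀ x, |deriv f x| ≤ M) ∧ (∀ x, |deriv (deriv f) x| ≤ M) ∧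
      (∀ x, L < |x| → f x = 0 ∧ deriv f x = 0 ∧ deriv (deriv f) x = 0) ∧
      (∀ x y, |deriv f y - deriv f x| ≤ M * |y - x|) ∧
      (∀ x y, |f y - f x - (y - x) * deriv f x| ≤ M * (y - x) ^ 2) := by
  have h1 : ContDiff ℝ 1 (deriv f) :=
    ((contDiff_succ_iff_deriv (n := 1) (f := f)).1 (by norm_num; exact hf)).2.2
  have h2 : Continuous (deriv (deriv f)) := h1.continuous_deriv le_rfl
  have d1 : ∀ x, HasDerivAt f (deriv f x) x := fun x =>
    (hf.differentiable (by norm_num) x).hasDerivAt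
  have d2 : ∀ x, HasDerivAt (deriv f) (deriv (deriv f) x) x := fun x =>
    (h1.differentiable (by norm_num) x).hasDerivAt
  obtain ⟨M₁, hM₁⟩ := h1.continuous.bounded_above_of_compact_support hc.deriv
  obtain ⟨M₂, hM₂⟩ := h2.bounded_above_of_compact_support hc.deriv.deriv
  obtain ⟨L, hL⟩ := hc.isCompact.isBounded.exists_norm_le
  have hM₂0 : 0 ≤ M₂ := (norm_nonneg _).trans (hM₂ 0)
  have lip : ∀ x y, |deriv f y - deriv f x| ≤ M₂ * |y - x| := fun x y =>
    convex_univ.norm_image_sub_le_of_norm_hasDerivWithin_le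
      (fun z _ => (d2 z).hasDerivWithinAt) (fun z _ => hM₂ z) (mem_univ x) (mem_univ y)
  refine ⟨d1, d2, max M₁ M₂, max L 0, le_max_of_le_right hM₂0, le_max_right _ _,
    fun x => (hM₁ x).trans (le_max_left _ _), fun x => (hM₂ x).trans (le_max_right _ _),
    fun x hx => ?_, fun x y => (lip x y).trans (by gcongr; exact le_max_right _ _),
    fun x y => ?_⟩
  · have hx' : x ∉ tsupport f := fun h =>
      absurd ((le_max_left L 0).trans_lt hx) (not_lt.2 (hL x h))
    have hx1 : x ∉ tsupport (deriv f) := fun h => hx' (tsupport_deriv_subset h)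
    have hx2 : x ∉ tsupport (deriv (deriv f)) := fun h => hx1 (tsupport_deriv_subset h)
    exact ⟨image_eq_zero_of_notMem_tsupport hx', image_eq_zero_of_notMem_tsupport hx1,
      image_eq_zero_of_notMem_tsupport hx2⟩
  · have hd : ∀ z ∈ uIcc x y, HasDerivWithinAt (fun z => f z - (z - x) * deriv f x)
        (deriv f z - deriv f x) (uIcc x y) z := fun z _ => by
      have := (d1 z).sub (((hasDerivAt_id z).sub_const x).mul_const (deriv f x))
      rw [one_mul] at this
      exact this.hasDerivWithinAt
    have hb : ∀ z ∈ uIcc x y, ‖deriv f z - deriv f x‖ ≤ M₂ * |y - x| := fun z hz =>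
      (lip x z).trans (mul_le_mul_of_nonneg_left (abs_sub_left_of_mem_uIcc hz) hM₂0)
    have := (convex_uIcc x y).norm_image_sub_le_of_norm_hasDerivWithin_le hd hb
      left_mem_uIcc right_mem_uIcc
    rw [Real.norm_eq_abs, Real.norm_eq_abs] at this
    calc |f y - f x - (y - x) * deriv f x|
        = |f y - (y - x) * deriv f x - (f x - (x - x) * deriv f x)| := by congr 1; ring
      _ ≤ M₂ * |y - x| * |y - x| := this
      _ = M₂ * (y - x) ^ 2 := by rw [mul_assoc, ← sq, sq_abs]
      _ ≤ _ := by gcongr; exact le_max_right _ _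

/-- A sequence bounded by `B` and supported in `|j| ≤ L / ε` has `ℓ²` norm `O(B / √ε)`. -/
theorem ellTwoNorm_le_of_scaled_support {f : ℤ → ℝ} {L ε B : ℝ} (hL : 0 ≤ L) (hε : 0 < ε)
    (hε1 : ε ≤ 1) (hB : 0 ≤ B) (hf : ∀ j : ℤ, ε * |(j : ℝ)| ≤ L → |f j| ≤ B)
    (h0 : ∀ j : ℤ, L < ε * |(j : ℝ)| → f j = 0) :
    ellTwoNorm f ≤ ENNReal.ofReal (Real.sqrt (2 * L + 1) * B / Real.sqrt ε) := by
  refine (ellTwoNorm_le_of_support (N := ⌊L / ε⌋₊) hB (fun j => ?_) (fun j hj => h0 j ?_)).trans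
    (ENNReal.ofReal_le_ofReal ?_)
  · rcases le_or_gt (ε * |(j : ℝ)|) L with h | h
    · exact hf j h
    · rw [h0 j h, abs_zero]; exact hB
  · rw [mul_comm, ← div_lt_iff₀ hε]
    have h1 : (⌊L / ε⌋₊ : ℤ) + 1 ≤ |j| := hj
    have h2 : ((⌊L / ε⌋₊ : ℝ)) + 1 ≤ |(j : ℝ)| := by exact_mod_cast h1
    exact (Nat.lt_floor_add_one _).trans_le h2
  · rw [mul_div_right_comm]
    refine mul_le_mul_of_nonneg_right ?_ hB
    rw [← Real.sqrt_div (by positivity)]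
    refine Real.sqrt_le_sqrt ?_
    rw [le_div_iff₀ hε]
    have : (⌊L / ε⌋₊ : ℝ) * ε ≤ L := by
      rw [← le_div_iff₀ hε]; exact Nat.floor_le (by positivity)
    nlinarith

set_option maxHeartbeats 1000000 in
/-- A profile `f` travelling with speed `σ`, where `σ² m̄ = k̃`, satisfies the lattice system up to
residuals that are `o(√ε)` in `ℓ²` after a correction which is itself `o(1 / √ε)`. The correctors
are `ε χₘ f' / m̄` for `k r` and `ε σ χₖ f'` for `p`, with `δ⁻ χₘ = m - m̄` and
`δ⁺ χₖ = 1 / k - 1 / k̃`. -/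
theorem exists_approximate_wave {m k χm χk : ℤ → ℝ} {c C kt mb σ : ℝ} (hc : 0 < c)
    (hm : ∀ j, m j ∈ Icc c C) (hk : ∀ j, k j ∈ Icc c C) (hmb : 0 < mb) (hσ : σ ≠ 0)
    (hσk : σ ^ 2 * mb = kt) (hχm : ∀ j, χm j - χm (j - 1) = m j - mb)
    (hχk : ∀ j, χk (j + 1) - χk j = 1 / k j - 1 / kt) (hsm : Sublinear χm) (hsk : Sublinear χk)
    {f : ℝ → ℝ} (hf : ContDiff ℝ 2 f) (hfc : HasCompactSupport f) {T₀ η : ℝ} (hT₀ : 0 < T₀)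
    (hη : 0 < η) :
    ∀ᶠ ε : ℝ in 𝓝[>] 0, ∃ R P R' P' : ℝ → EllTwo,
      (∀ t, HasDerivAt R (R' t) t) ∧ (∀ t, HasDerivAt P (P' t) t) ∧
      ∀ t ∈ Icc (-(T₀ / ε)) (T₀ / ε),
        ellTwoNorm (fun j => R' t j - deltaPlus (P t) j) ≤ ENNReal.ofReal (η * Real.sqrt ε) ∧
        ellTwoNorm (fun j => m j * P' t j - deltaMinus (fun i => k i * R t i) j)
          ≤ ENNReal.ofReal (η * Real.sqrt ε) ∧
        ellTwoNorm (fun j => R t j - 1 / k j * f (ε * j + σ * (ε * t)))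
          ≤ ENNReal.ofReal (η / Real.sqrt ε) ∧
        ellTwoNorm (fun j => P t j - 1 / (σ * mb) * f (ε * j + σ * (ε * t)))
          ≤ ENNReal.ofReal (η / Real.sqrt ε) := by
  obtain ⟨d1, d2, M, L₀, hM, hL₀, b1, b2, h0, lip, tay⟩ := exists_profile_bounds hf hfc
  set f1 := deriv f
  set f2 := deriv f1
  -- The extra `1` leaves room for the neighbouring sites `j ± 1`.
  set L : ℝ := L₀ + |σ| * T₀ + 1 with hLdef
  have hL : 0 ≤ L := by positivity
  have hC : 0 < C := hc.trans_le ((hm 0).1.trans (hm 0).2)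
  have hσ' : 0 < |σ| := abs_pos.2 hσ
  -- `D` collects the constants of all error terms: each residual is at most `ε D β` and each
  -- corrector at most `D β` pointwise, once `ε`, `ε |χₘ|` and `ε |χₖ|` are at most `β`.
  set D : ℝ := M / (|σ| * mb) + 1 / c * (|σ| / mb) * M + |σ| * M + M + C * σ ^ 2 * M + M / mb +
    1 / c * (M / mb) + 1 with hD
  have hDp : 0 < D := by positivity
  have q1 : 0 ≤ M / (|σ| * mb) := by positivity
  have q2 : 0 ≤ 1 / c * (|σ| / mb) * M := by positivity
  have q3 : 0 ≤ |σ| * M := by positivity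
  have q4 : 0 ≤ C * σ ^ 2 * M := by positivity
  have q5 : 0 ≤ M / mb := by positivity
  have q6 : 0 ≤ 1 / c * (M / mb) := by positivity
  have hD1 : M / (|σ| * mb) + 1 / c * (|σ| / mb) * M + |σ| * M ≤ D := by linarith
  have hD2 : M + C * σ ^ 2 * M + M / mb ≤ D := by linarith
  have hD3 : 1 / c * (M / mb) ≤ D := by linarith
  have hD4 : |σ| * M ≤ D := by linarith
  clear_value D
  set W := Real.sqrt (2 * L + 1)
  have hW : 0 < W := Real.sqrt_pos.2 (by positivity)
  set β : ℝ := η / (W * D) with hβdef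
  have hβ : 0 < β := by positivity
  have hWD : W * (D * β) = η := by rw [hβdef]; field_simp
  filter_upwards [hsm.eventually_mul_le (L := L + 1) (by positivity) hβ,
    hsk.eventually_mul_le (L := L + 1) (by positivity) hβ, self_mem_nhdsWithin,
    Ioo_mem_nhdsGT (lt_min one_pos hβ)] with ε em ek hε hε2
  have hε : 0 < ε := hε
  have hε1 : ε ≤ 1 := hε2.2.le.trans (min_le_left _ _)
  have hεβ : ε ≤ β := hε2.2.le.trans (min_le_right _ _)
  set x : ℝ → ℤ → ℝ := fun t j => ε * j + σ * (ε * t) with hx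
  have xs : ∀ t j, x t (j + 1) = x t j + ε := fun t j => by simp only [hx]; push_cast; ring
  have xp : ∀ t j, x t (j - 1) = x t j - ε := fun t j => by simp only [hx]; push_cast; ring
  have dx : ∀ t j, HasDerivAt (fun t => x t j) (σ * ε) t := fun t j => by
    have := (((hasDerivAt_id t).const_mul ε).const_mul σ).const_add (ε * (j : ℝ))
    simpa only [mul_one, id] using this
  set a : ℝ → ℤ → ℝ := fun t j => 1 / k j * (f (x t j) + ε * χm j / mb * f1 (x t j)) with ha
  set a' : ℝ → ℤ → ℝ := fun t j =>
    1 / k j * (f1 (x t j) * (σ * ε) + ε * χm j / mb * (f2 (x t j) * (σ * ε))) with ha'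
  set b : ℝ → ℤ → ℝ := fun t j => 1 / (σ * mb) * f (x t j) + ε * χk j * σ * f1 (x t j) with hb
  set b' : ℝ → ℤ → ℝ := fun t j =>
    1 / (σ * mb) * (f1 (x t j) * (σ * ε)) + ε * χk j * σ * (f2 (x t j) * (σ * ε)) with hb'
  have df : ∀ t j, HasDerivAt (fun t => f (x t j)) (f1 (x t j) * (σ * ε)) t := fun t j =>
    (d1 (x t j)).comp t (dx t j)
  have df1 : ∀ t j, HasDerivAt (fun t => f1 (x t j)) (f2 (x t j) * (σ * ε)) t := fun t j =>
    HasDerivAt.comp t (h₂ := f1) (d2 (x t j)) (dx t j)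
  have da : ∀ t j, HasDerivAt (fun t => a t j) (a' t j) t := fun t j =>
    ((df t j).add ((df1 t j).const_mul _)).const_mul _
  have db : ∀ t j, HasDerivAt (fun t => b t j) (b' t j) t := fun t j =>
    ((df t j).const_mul _).add ((df1 t j).const_mul _)
  have out : ∀ t ∈ Icc (-(T₀ / ε)) (T₀ / ε), ∀ j : ℤ, L - 1 < ε * |(j : ℝ)| →
      f (x t j) = 0 ∧ f1 (x t j) = 0 ∧ f2 (x t j) = 0 := by
    intro t ht j hj
    refine h0 _ ?_
    have h1 : |σ * (ε * t)| ≤ |σ| * T₀ := by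
      rw [abs_mul, abs_mul, abs_of_pos hε]
      gcongr
      calc ε * |t| ≤ ε * (T₀ / ε) := by gcongr; exact abs_le.2 ht
        _ = T₀ := by field_simp
    have h2 : ε * |(j : ℝ)| ≤ |x t j| + |σ * (ε * t)| := by
      rw [← abs_of_pos hε, ← abs_mul, abs_of_pos hε]
      calc |ε * (j : ℝ)| = |x t j - σ * (ε * t)| := by congr 1; simp only [hx]; ring
        _ ≤ _ := abs_sub _ _
    linarith
  obtain ⟨S, hS⟩ : ∃ S : Finset ℤ, ∀ j, j ∉ S → L < ε * |(j : ℝ)| := by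
    refine ⟨Finset.Icc (-⌊L / ε⌋₊) ⌊L / ε⌋₊, fun j hj => ?_⟩
    rw [Finset.mem_Icc, ← abs_le, not_le] at hj
    rw [mul_comm, ← div_lt_iff₀ hε]
    have h1 : (⌊L / ε⌋₊ : ℤ) + 1 ≤ |j| := hj
    have h2 : ((⌊L / ε⌋₊ : ℝ)) + 1 ≤ |(j : ℝ)| := by exact_mod_cast h1
    exact (Nat.lt_floor_add_one _).trans_le h2
  obtain ⟨R, R', hR, hRa, hRa'⟩ := exists_hasDerivAt_ellTwo S da
  obtain ⟨P, P', hP, hPb, hPb'⟩ := exists_hasDerivAt_ellTwo S db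
  refine ⟨R, P, R', P', hR, hP, fun t ht => ?_⟩
  have oS : ∀ j ∉ S, f (x t j) = 0 ∧ f1 (x t j) = 0 ∧ f2 (x t j) = 0 := fun j hj =>
    out t ht j (by linarith [hS j hj])
  have eR : ∀ j, R t j = a t j := fun j => by
    rw [hRa]; split_ifs with h
    · rfl
    · obtain ⟨e1, e2, e3⟩ := oS j h; simp [ha, e1, e2]
  have eR' : ∀ j, R' t j = a' t j := fun j => by
    rw [hRa']; split_ifs with h
    · rfl
    · obtain ⟨e1, e2, e3⟩ := oS j h; simp [ha', e2, e3]
  have eP : ∀ j, P t j = b t j := fun j => by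
    rw [hPb]; split_ifs with h
    · rfl
    · obtain ⟨e1, e2, e3⟩ := oS j h; simp [hb, e1, e2]
  have eP' : ∀ j, P' t j = b' t j := fun j => by
    rw [hPb']; split_ifs with h
    · rfl
    · obtain ⟨e1, e2, e3⟩ := oS j h; simp [hb', e2, e3]
  have jp : ∀ j : ℤ, ε * |((j + 1 : ℤ) : ℝ)| ≤ ε * |(j : ℝ)| + 1 ∧
      ε * |(j : ℝ)| - 1 ≤ ε * |((j + 1 : ℤ) : ℝ)| := fun j => by
    push_cast
    have h1 : |(j : ℝ) + 1| ≤ |(j : ℝ)| + 1 := (abs_add_le _ _).trans (by simp)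
    have h2 : |(j : ℝ)| ≤ |(j : ℝ) + 1| + 1 := by
      calc |(j : ℝ)| = |(j : ℝ) + 1 - 1| := by congr 1; ring
        _ ≤ _ := (abs_sub _ _).trans (by simp)
    constructor <;> nlinarith
  have jm : ∀ j : ℤ, ε * |((j - 1 : ℤ) : ℝ)| ≤ ε * |(j : ℝ)| + 1 ∧
      ε * |(j : ℝ)| - 1 ≤ ε * |((j - 1 : ℤ) : ℝ)| := fun j => by
    have := jp (j - 1)
    rw [sub_add_cancel] at this
    constructor <;> linarith [this.1, this.2]
  have kc : ∀ j, |1 / k j| ≤ 1 / c := fun j => by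
    rw [abs_of_pos (one_div_pos.2 (hc.trans_le (hk j).1))]
    exact one_div_le_one_div_of_le hc (hk j).1
  have k0 : ∀ j, k j ≠ 0 := fun j => (hc.trans_le (hk j).1).ne'
  have mC : ∀ j, |m j| ≤ C := fun j =>
    abs_le.2 ⟨by linarith [(hm j).1], (hm j).2⟩
  have em' : ∀ j : ℤ, ε * |(j : ℝ)| ≤ L + 1 → |ε * χm j| ≤ β := fun j hj => by
    rw [abs_mul, abs_of_pos hε]; exact em j hj
  have ek' : ∀ j : ℤ, ε * |(j : ℝ)| ≤ L + 1 → |ε * χk j| ≤ β := fun j hj => by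
    rw [abs_mul, abs_of_pos hε]; exact ek j hj
  have hsq : ε / Real.sqrt ε = Real.sqrt ε := Real.div_sqrt
  have res : W * (ε * (D * β)) / Real.sqrt ε = η * Real.sqrt ε := by
    rw [← hWD]
    calc W * (ε * (D * β)) / Real.sqrt ε = W * (D * β) * (ε / Real.sqrt ε) := by ring
      _ = _ := by rw [hsq]
  have hεβ0 : 0 ≤ ε * β := by positivity
  refine ⟨?_, ?_, ?_, ?_⟩
  · rw [← res]
    refine ellTwoNorm_le_of_scaled_support hL hε hε1 (by positivity) (fun j hj => ?_)
      (fun j hj => ?_)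
    · -- The terms of order `ε` cancel by `δ⁺ χₖ = 1 / k - 1 / k̃` and `σ² m̄ = k̃`.
      have id1 : R' t j - deltaPlus (P t) j =
          -(1 / (σ * mb) * (f (x t j + ε) - f (x t j) - (x t j + ε - x t j) * f1 (x t j))) +
          1 / k j * (ε * χm j / mb * (f2 (x t j) * (σ * ε))) -
          ε * χk (j + 1) * σ * (f1 (x t j + ε) - f1 (x t j)) := by
        have e : χk (j + 1) = χk j + (1 / k j - 1 / kt) := by linarith [hχk j]
        rw [deltaPlus, eR', eP, eP]
        simp only [ha', hb, xs, e, ← hσk]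
        field_simp
        ring
      have t1 : |1 / (σ * mb) * (f (x t j + ε) - f (x t j) - (x t j + ε - x t j) * f1 (x t j))|
          ≤ M / (|σ| * mb) * (ε * ε) := by
        have := tay (x t j) (x t j + ε)
        rw [abs_mul, abs_div, abs_one, abs_mul, abs_of_pos hmb]
        calc _ ≤ 1 / (|σ| * mb) * (M * (x t j + ε - x t j) ^ 2) := by gcongr
          _ = _ := by ring
      have t2 : |1 / k j * (ε * χm j / mb * (f2 (x t j) * (σ * ε)))|
          ≤ 1 / c * (|σ| / mb) * M * (ε * β) := by
        rw [abs_mul, abs_mul, abs_mul (f2 _), abs_div _ mb, abs_mul σ, abs_of_pos hmb,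
          abs_of_pos hε]
        calc _ ≤ 1 / c * (β / mb * (M * (|σ| * ε))) := by
              gcongr
              · exact kc j
              · exact em' j (by linarith)
              · exact b2 _
          _ = _ := by ring
      have t3 : |ε * χk (j + 1) * σ * (f1 (x t j + ε) - f1 (x t j))| ≤ |σ| * M * (ε * β) := by
        have := lip (x t j) (x t j + ε)
        rw [add_sub_cancel_left, abs_of_pos hε] at this
        rw [abs_mul, abs_mul]
        calc _ ≤ β * |σ| * (M * ε) := by
              gcongr
              exact ek' (j + 1) (by linarith [(jp j).1])
          _ = _ := by ring
      rw [id1]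
      refine (abs_sub _ _).trans ((add_le_add (abs_add_le _ _) le_rfl).trans ?_)
      rw [abs_neg]
      have : M / (|σ| * mb) * (ε * ε) ≤ M / (|σ| * mb) * (ε * β) := by gcongr
      have := mul_le_mul_of_nonneg_right hD1 hεβ0
      linarith
    · obtain ⟨e1, e2, e3⟩ := out t ht j (by linarith)
      obtain ⟨g1, g2, g3⟩ := out t ht (j + 1) (by linarith [(jp j).2])
      rw [deltaPlus, eR', eP, eP]
      simp [ha', hb, e1, e2, e3, g1, g2]
  · rw [← res]
    refine ellTwoNorm_le_of_scaled_support hL hε hε1 (by positivity) (fun j hj => ?_)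
      (fun j hj => ?_)
    · -- The terms of order `ε` cancel by `δ⁻ χₘ = m - m̄`.
      have id1 : m j * P' t j - deltaMinus (fun i => k i * R t i) j =
          (f (x t j - ε) - f (x t j) - (x t j - ε - x t j) * f1 (x t j)) +
          m j * (ε * χk j * σ * (f2 (x t j) * (σ * ε))) -
          ε * χm (j - 1) / mb * (f1 (x t j) - f1 (x t j - ε)) := by
        have e : χm j = χm (j - 1) + (m j - mb) := by linarith [hχm j]
        have kj := k0 j
        have kj' := k0 (j - 1)
        rw [deltaMinus, eP', eR, eR]
        simp only [ha, hb', xp, e]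
        field_simp
        ring
      have t1 : |f (x t j - ε) - f (x t j) - (x t j - ε - x t j) * f1 (x t j)|
          ≤ M * (ε * ε) := by
        refine (tay (x t j) (x t j - ε)).trans (le_of_eq ?_)
        ring
      have t2 : |m j * (ε * χk j * σ * (f2 (x t j) * (σ * ε)))| ≤ C * σ ^ 2 * M * (ε * β) := by
        rw [abs_mul, abs_mul, abs_mul (ε * χk j), abs_mul (f2 _), abs_mul σ ε, abs_of_pos hε]
        calc _ ≤ C * (β * |σ| * (M * (|σ| * ε))) := by
              gcongr
              · exact mC j
              · exact ek' j (by linarith)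
              · exact b2 _
          _ = C * |σ| ^ 2 * M * (ε * β) := by ring
          _ = _ := by rw [sq_abs]
      have t3 : |ε * χm (j - 1) / mb * (f1 (x t j) - f1 (x t j - ε))| ≤ M / mb * (ε * β) := by
        have := lip (x t j - ε) (x t j)
        rw [sub_sub_cancel, abs_of_pos hε] at this
        rw [abs_mul, abs_div, abs_of_pos hmb]
        calc _ ≤ β / mb * (M * ε) := by
              gcongr
              exact em' (j - 1) (by linarith [(jm j).1])
          _ = _ := by ring
      rw [id1]
      refine (abs_sub _ _).trans ((add_le_add (abs_add_le _ _) le_rfl).trans ?_)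
      have : M * (ε * ε) ≤ M * (ε * β) := by gcongr
      have := mul_le_mul_of_nonneg_right hD2 hεβ0
      linarith
    · obtain ⟨e1, e2, e3⟩ := out t ht j (by linarith)
      obtain ⟨g1, g2, g3⟩ := out t ht (j - 1) (by linarith [(jm j).2])
      rw [deltaMinus, eP', eR, eR]
      simp [ha, hb', e1, e2, e3, g1, g2]
  · rw [← hWD]
    refine ellTwoNorm_le_of_scaled_support hL hε hε1 (by positivity) (fun j hj => ?_)
      (fun j hj => ?_)
    · have id1 : R t j - 1 / k j * f (ε * j + σ * (ε * t)) =
          1 / k j * (ε * χm j / mb * f1 (x t j)) := by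
        rw [eR]; simp only [ha, hx]; ring
      rw [id1, abs_mul, abs_mul, abs_div _ mb, abs_of_pos hmb]
      have : |1 / k j| * (|ε * χm j| / mb * |f1 (x t j)|) ≤ 1 / c * (β / mb * M) := by
        gcongr
        · exact kc j
        · exact em' j (by linarith)
        · exact b1 _
      have e : 1 / c * (β / mb * M) = 1 / c * (M / mb) * β := by ring
      exact this.trans (e.trans_le (mul_le_mul_of_nonneg_right hD3 hβ.le))
    · obtain ⟨e1, e2, e3⟩ := out t ht j (by linarith)
      have e1' : f (ε * j + σ * (ε * t)) = 0 := e1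
      rw [eR]
      simp [ha, e1, e2, e1']
  · rw [← hWD]
    refine ellTwoNorm_le_of_scaled_support hL hε hε1 (by positivity) (fun j hj => ?_)
      (fun j hj => ?_)
    · have id1 : P t j - 1 / (σ * mb) * f (ε * j + σ * (ε * t)) =
          ε * χk j * σ * f1 (x t j) := by
        rw [eP]; simp only [hb, hx]; ring
      rw [id1, abs_mul, abs_mul]
      have : |ε * χk j| * |σ| * |f1 (x t j)| ≤ β * |σ| * M := by
        gcongr
        · exact ek' j (by linarith)
        · exact b1 _
      have := mul_le_mul_of_nonneg_right hD4 hβ.le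
      linarith
    · obtain ⟨e1, e2, e3⟩ := out t ht j (by linarith)
      have e1' : f (ε * j + σ * (ε * t)) = 0 := e1
      rw [eP]
      simp [hb, e1, e2, e1']

/-! ### Weak derivatives on the line -/

/-- The primitive of a locally integrable function has that function as its weak derivative. -/
theorem integral_primitive_mul_deriv {G φ : ℝ → ℝ} (hG : LocallyIntegrable G)
    (hφ : ContDiff ℝ 1 φ) (hc : HasCompactSupport φ) :
    ∫ x, (∫ y in (0 : ℝ)..x, G y) * deriv φ x = -∫ x, G x * φ x := by
  obtain ⟨L, hL⟩ := hc.isCompact.isBounded.exists_norm_le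
  set K : ℝ := max L 0 + 1
  have hK : 0 < K := by positivity
  have out : ∀ x, x ∉ Ioc (-K) K → x ∉ tsupport φ := by
    intro x hx h
    have h1 : |x| ≤ L := hL x h
    have h2 := abs_le.1 h1
    have h3 : L < K := (le_max_left L 0).trans_lt (lt_add_one _)
    exact hx ⟨by linarith, by linarith⟩
  have hGi : IntervalIntegrable G volume (-K) K := by
    rw [intervalIntegrable_iff_integrableOn_Icc_of_le (by linarith)]
    exact hG.integrableOn_isCompact isCompact_Icc
  have e0 : ∀ x, x ∉ tsupport φ → φ x = 0 := fun x => image_eq_zero_of_notMem_tsupport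
  have e1 : ∫ x, (∫ y in (0 : ℝ)..x, G y) * deriv φ x =
      ∫ x in (-K)..K, (∫ y in (0 : ℝ)..x, G y) * deriv φ x := by
    rw [intervalIntegral.integral_of_le (by linarith),
      setIntegral_eq_integral_of_forall_compl_eq_zero]
    intro x hx
    rw [image_eq_zero_of_notMem_tsupport (fun h => out x hx (tsupport_deriv_subset h)), mul_zero]
  have e2 : ∫ x, G x * φ x = ∫ x in (-K)..K, G x * φ x := by
    rw [intervalIntegral.integral_of_le (by linarith),
      setIntegral_eq_integral_of_forall_compl_eq_zero]
    intro x hx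
    rw [e0 x (out x hx), mul_zero]
  have h0 : (0 : ℝ) ∈ uIcc (-K) K := by
    rw [uIcc_of_le (by linarith)]; exact ⟨by linarith, hK.le⟩
  have ac1 := hGi.absolutelyContinuousOnInterval_intervalIntegral h0
  have ac2 : AbsolutelyContinuousOnInterval φ (-K) K := hφ.contDiffOn.absolutelyContinuousOnInterval
  rw [e1, e2, ac1.integral_mul_deriv_eq_deriv_mul ac2]
  have z1 : φ (-K) = 0 := e0 _ (out _ fun h => lt_irrefl _ h.1)
  have z2 : φ K = 0 := by
    refine e0 _ fun h => ?_
    have h1 : |K| ≤ L := hL K h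
    have h3 : L < K := (le_max_left L 0).trans_lt (lt_add_one _)
    linarith [le_abs_self K]
  rw [z1, z2, mul_zero, mul_zero, sub_zero, zero_sub]
  congr 1
  refine intervalIntegral.integral_congr_ae ?_
  filter_upwards [hGi.ae_hasDerivAt_integral] with x hx hx'
  rw [(hx (uIoc_subset_uIcc hx') 0 h0).deriv]

/-- A locally integrable function whose weak derivative vanishes is constant. -/
theorem ae_eq_const_of_integral_mul_deriv_eq_zero {D : ℝ → ℝ} (hD : LocallyIntegrable D)
    (h : ∀ φ : ℝ → ℝ, ContDiff ℝ ((⊤ : ℕ∞) : WithTop ℕ∞) φ → HasCompactSupport φ →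
      ∫ x, D x * deriv φ x = 0) : ∃ C : ℝ, ∀ᵐ x, D x = C := by
  -- A fixed bump of integral one reduces every test function to a derivative.
  let β : ContDiffBump (0 : ℝ) := ⟨1, 2, one_pos, by norm_num⟩
  set θ : ℝ → ℝ := β.normed volume
  have hθ : ContDiff ℝ ((⊤ : ℕ∞) : WithTop ℕ∞) θ := β.contDiff_normed
  have hθc : HasCompactSupport θ := β.hasCompactSupport_normed
  have hθ1 : ∫ x, θ x = 1 := β.integral_normed
  have hint : ∀ ψ : ℝ → ℝ, Continuous ψ → HasCompactSupport ψ → Integrable (fun x => D x * ψ x) :=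
    fun ψ hψ hc => by
      have := hD.integrable_smul_left_of_hasCompactSupport hψ hc
      exact this.congr (Eventually.of_forall fun x => mul_comm _ _)
  set C := ∫ x, D x * θ x with hC
  refine ⟨C, ?_⟩
  have key := ae_eq_zero_of_integral_contDiff_smul_eq_zero (f := fun x => D x - C) (μ := volume)
    (hD.sub (locallyIntegrable_const C)) ?_
  · filter_upwards [key] with x hx
    linarith
  intro ψ hψ hψc
  set I := ∫ x, ψ x
  have hψi : Integrable ψ := hψ.continuous.integrable_of_hasCompactSupport hψc
  have hθi : Integrable θ := hθ.continuous.integrable_of_hasCompactSupport hθc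
  set u : ℝ → ℝ := fun x => ψ x - I * θ x with hu
  have huc : HasCompactSupport u := hψc.sub (hθc.mul_left)
  have hus : ContDiff ℝ ((⊤ : ℕ∞) : WithTop ℕ∞) u := hψ.sub (contDiff_const.mul hθ)
  have hui : Integrable u := hψi.sub (hθi.const_mul I)
  have hu0 : ∫ x, u x = 0 := by
    rw [hu, integral_sub hψi (hθi.const_mul I), integral_const_mul, hθ1]; simp [I]
  set U : ℝ → ℝ := fun x => ∫ y in Iic x, u y with hU
  have hUd : ∀ x, HasDerivAt U (u x) x := by
    intro x
    have : U = fun x => (∫ y in Iic (0 : ℝ), u y) + ∫ y in (0 : ℝ)..x, u y := by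
      funext z
      rw [intervalIntegral.integral_Iic_sub_Iic hui.integrableOn hui.integrableOn |>.symm]
      simp [hU]
    rw [this]
    exact (intervalIntegral.integral_hasDerivAt_right (hus.continuous.intervalIntegrable _ _)
      hus.continuous.aestronglyMeasurable.stronglyMeasurableAtFilter
      hus.continuous.continuousAt).const_add _
  have hdU : deriv U = u := funext fun x => (hUd x).deriv
  have hUs : ContDiff ℝ ((⊤ : ℕ∞) : WithTop ℕ∞) U := by
    rw [contDiff_infty_iff_deriv, hdU]
    exact ⟨fun x => (hUd x).differentiableAt, hus⟩
  have hUc : HasCompactSupport U := by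
    obtain ⟨L, hL⟩ := huc.isCompact.isBounded.exists_norm_le
    refine HasCompactSupport.intro (isCompact_Icc (a := -L) (b := L)) fun x hx => ?_
    have out : ∀ y, L < |y| → u y = 0 := fun y hy =>
      image_eq_zero_of_notMem_tsupport fun h => absurd (hL y h) (not_le.2 hy)
    rcases lt_or_ge x (-L) with h1 | h1
    · refine setIntegral_eq_zero_of_forall_eq_zero fun y hy => out y ?_
      have : y ≤ x := hy
      exact lt_of_lt_of_le (by linarith) (neg_le_abs y)
    · have h2 : L < x := by
        by_contra hc
        exact hx ⟨h1, not_lt.1 hc⟩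
      rw [← hu0]
      refine setIntegral_eq_integral_of_forall_compl_eq_zero fun y hy => out y ?_
      have : x < y := not_le.1 hy
      exact lt_of_lt_of_le (by linarith) (le_abs_self y)
  have h1 := h U hUs hUc
  rw [hdU] at h1
  have h2 : ∫ x, D x * u x = (∫ x, D x * ψ x) - I * C := by
    rw [hC, ← integral_const_mul, ← integral_sub (hint ψ hψ.continuous hψc)
      ((hint θ hθ.continuous hθc).const_mul I)]
    congr 1; funext x; simp only [hu]; ring
  have h3 : ∫ x, ψ x • (D x - C) = (∫ x, D x * ψ x) - C * I := by
    rw [← integral_const_mul, ← integral_sub (hint ψ hψ.continuous hψc) (hψi.const_mul C)]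
    congr 1; funext x; simp only [smul_eq_mul]; ring
  rw [h3]; linarith

/-- A function with a locally integrable weak derivative is almost everywhere a primitive of it. -/
theorem ae_eq_primitive_of_weakDeriv {F G : ℝ → ℝ} (hF : LocallyIntegrable F)
    (hG : LocallyIntegrable G)
    (h : ∀ φ : ℝ → ℝ, ContDiff ℝ ((⊤ : ℕ∞) : WithTop ℕ∞) φ → HasCompactSupport φ →
      ∫ x, F x * deriv φ x = -∫ x, G x * φ x) :
    ∃ C : ℝ, ∀ᵐ x, F x = C + ∫ y in (0 : ℝ)..x, G y := by
  have hcont : Continuous fun x => ∫ y in (0 : ℝ)..x, G y :=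
    intervalIntegral.continuous_primitive
      (fun a b => (hG.integrableOn_isCompact isCompact_uIcc).intervalIntegrable) 0
  have hH := hcont.locallyIntegrable (μ := volume)
  obtain ⟨C, hC⟩ := ae_eq_const_of_integral_mul_deriv_eq_zero (hF.sub hH) fun φ hφ hc => by
    have hd : Continuous (deriv φ) := hφ.continuous_deriv (by exact_mod_cast le_top)
    have i1 : ∀ {E : ℝ → ℝ}, LocallyIntegrable E → Integrable (fun x => E x * deriv φ x) :=
      fun hE => (hE.integrable_smul_left_of_hasCompactSupport hd hc.deriv).congr
        (Eventually.of_forall fun x => mul_comm _ _)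
    simp only [Pi.sub_apply, sub_mul]
    rw [integral_sub (i1 hF) (i1 hH), h φ hφ hc,
      integral_primitive_mul_deriv hG (hφ.of_le (by exact_mod_cast le_top)) hc, sub_self]
  refine ⟨C, ?_⟩
  filter_upwards [hC] with x hx
  simp only [Pi.sub_apply] at hx
  linarith

theorem one_le_lilWeight (x : ℝ) : 1 ≤ lilWeight x := by
  refine Real.one_le_sqrt.2
    (le_add_of_nonneg_right (mul_nonneg (abs_nonneg _) (Real.log_nonneg ?_)))
  rw [← Real.log_exp 1]
  exact Real.log_le_log (Real.exp_pos _) (by simp)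

/-- The weight is at least one, so weighted square integrability implies the unweighted one. -/
theorem memLp_of_lilWeight_mul {G : ℝ → ℝ} (hG : LocallyIntegrable G)
    (h : MemLp (fun x => lilWeight x * G x) 2 volume) : MemLp G 2 volume :=
  h.mono hG.aestronglyMeasurable (Eventually.of_forall fun x => by
    rw [norm_mul]
    exact le_mul_of_one_le_left (norm_nonneg _)
      ((one_le_lilWeight x).trans (Real.le_norm_self _)))

/-- Successive weak derivatives of `F` are weak derivatives of each other. -/
theorem IsWeakDeriv.integral_mul_deriv {i : ℕ} {F G G' : ℝ → ℝ} (h : IsWeakDeriv i F G)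
    (h' : IsWeakDeriv (i + 1) F G') {φ : ℝ → ℝ}
    (hφ : ContDiff ℝ ((⊤ : ℕ∞) : WithTop ℕ∞) φ) (hc : HasCompactSupport φ) :
    ∫ x, G x * deriv φ x = -∫ x, G' x * φ x := by
  have e1 := h.2.2 (deriv φ) (contDiff_infty_iff_deriv.1 hφ).2 hc.deriv
  have e2 := h'.2.2 φ hφ hc
  rw [iteratedDeriv_succ', e1, pow_succ] at e2
  have : ((-1 : ℝ) ^ i) ≠ 0 := pow_ne_zero _ (by norm_num)
  refine mul_left_cancel₀ this ?_
  rw [e2]; ring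

/-- An element of `H³` with the weight is `C²`, and it is square integrable together with its first
derivative. -/
theorem MemHLIL.regularity {F : ℝ → ℝ} (hF : MemHLIL 3 F) :
    ContDiff ℝ 2 F ∧ MemLp F 2 volume ∧ MemLp (deriv F) 2 volume := by
  obtain ⟨hFc, hF⟩ := hF
  obtain ⟨G0, w0, l0⟩ := hF 0 (by norm_num)
  obtain ⟨G1, w1, l1⟩ := hF 1 (by norm_num)
  obtain ⟨G2, w2, -⟩ := hF 2 (by norm_num)
  obtain ⟨G3, w3, -⟩ := hF 3 (by norm_num)
  have a0 : ∀ᵐ x, G0 x = F x := by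
    refine ae_eq_of_integral_contDiff_smul_eq w0.2.1 w0.1 fun φ hφ hc => ?_
    have := w0.2.2 φ hφ hc
    simp only [iteratedDeriv_zero, pow_zero, one_mul] at this
    simp only [smul_eq_mul, mul_comm (φ _)]
    exact this.symm
  have m0 := memLp_of_lilWeight_mul w0.2.1 l0
  have m1 := memLp_of_lilWeight_mul w1.2.1 l1
  obtain ⟨C2, h2⟩ := ae_eq_primitive_of_weakDeriv w2.2.1 w3.2.1
    fun φ hφ hc => w2.integral_mul_deriv w3 hφ hc
  obtain ⟨C1, h1⟩ := ae_eq_primitive_of_weakDeriv w1.2.1 w2.2.1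
    fun φ hφ hc => w1.integral_mul_deriv w2 hφ hc
  obtain ⟨C0, h0⟩ := ae_eq_primitive_of_weakDeriv w1.1 w1.2.1 fun φ hφ hc => by
    have := w1.2.2 φ hφ hc
    rw [iteratedDeriv_one, pow_one, neg_one_mul] at this
    exact this
  set g2 : ℝ → ℝ := fun x => C2 + ∫ y in (0 : ℝ)..x, G3 y with hg2
  set g1 : ℝ → ℝ := fun x => C1 + ∫ y in (0 : ℝ)..x, g2 y with hg1
  have c2 : Continuous g2 := continuous_const.add (intervalIntegral.continuous_primitive
    (fun a b => (w3.2.1.integrableOn_isCompact isCompact_uIcc).intervalIntegrable) 0)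
  have d1 : ∀ x, HasDerivAt g1 (g2 x) x := fun x =>
    (c2.integral_hasStrictDerivAt 0 x).hasDerivAt.const_add C1
  have h1' : ∀ᵐ x, G1 x = g1 x := by
    filter_upwards [h1] with x hx
    rw [hx, hg1]
    congr 1
    exact intervalIntegral.integral_congr_ae (h2.mono fun y hy _ => hy)
  have c1 : Continuous g1 := continuous_iff_continuousAt.2 fun x => (d1 x).continuousAt
  have hFe : F = fun x => C0 + ∫ y in (0 : ℝ)..x, g1 y := by
    refine Continuous.ae_eq_iff_eq volume hFc
      (continuous_const.add (intervalIntegral.continuous_primitive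
        (fun a b => c1.intervalIntegrable _ _) 0)) |>.1 ?_
    filter_upwards [h0] with x hx
    rw [hx]
    congr 1
    exact intervalIntegral.integral_congr_ae (h1'.mono fun y hy _ => hy)
  have d0 : ∀ x, HasDerivAt F (g1 x) x := fun x => by
    rw [hFe]
    exact (c1.integral_hasStrictDerivAt 0 x).hasDerivAt.const_add C0
  have dF : deriv F = g1 := funext fun x => (d0 x).deriv
  have dg : deriv g1 = g2 := funext fun x => (d1 x).deriv
  have s1 : ContDiff ℝ 1 g1 := by
    rw [contDiff_one_iff_deriv, dg]
    exact ⟨fun x => (d1 x).differentiableAt, c2⟩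
  refine ⟨?_, m0.ae_eq a0, ?_⟩
  · have : ContDiff ℝ (1 + 1) F := by
      rw [contDiff_succ_iff_deriv, dF]
      exact ⟨fun x => (d0 x).differentiableAt, by simp, s1⟩
    exact this.of_le (by norm_num)
  · rw [dF]
    exact m1.ae_eq h1'

/-! ### Sampling and density of compactly supported profiles -/

/-- The Cauchy–Schwarz inequality against the constant function, by completing the square with the
mean value. -/
theorem sq_intervalIntegral_le {g : ℝ → ℝ} (hg : Continuous g) {a b : ℝ} (hab : a ≤ b) :
    (∫ x in a..b, g x) ^ 2 ≤ (b - a) * ∫ x in a..b, g x ^ 2 := by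
  rcases hab.eq_or_lt with rfl | hlt
  · simp
  set I := ∫ x in a..b, g x
  have h0 : 0 ≤ ∫ x in a..b, ((b - a) * g x - I) ^ 2 :=
    intervalIntegral.integral_nonneg hab fun _ _ => sq_nonneg _
  have h1 : ∫ x in a..b, ((b - a) * g x - I) ^ 2 =
      (b - a) * ((b - a) * (∫ x in a..b, g x ^ 2) - I ^ 2) := by
    have e : ∀ x, ((b - a) * g x - I) ^ 2 =
        (b - a) ^ 2 * g x ^ 2 - 2 * (b - a) * I * g x + I ^ 2 := fun x => by ring
    have i1 : IntervalIntegrable (fun x => (b - a) ^ 2 * g x ^ 2) volume a b :=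
      (continuous_const.mul (hg.pow 2)).intervalIntegrable _ _
    have i2 : IntervalIntegrable (fun x => 2 * (b - a) * I * g x) volume a b :=
      (continuous_const.mul hg).intervalIntegrable _ _
    simp only [e]
    rw [intervalIntegral.integral_add (i1.sub i2) (by simp), intervalIntegral.integral_sub i1 i2,
      intervalIntegral.integral_const_mul, intervalIntegral.integral_const_mul,
      intervalIntegral.integral_const, smul_eq_mul]
    change _ - 2 * (b - a) * I * I + _ = _
    ring
  rw [h1] at h0
  linarith [nonneg_of_mul_nonneg_right h0 (sub_pos.2 hlt)]

/-- One-dimensional trace inequality on an interval of length `ε`. -/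
theorem mul_sq_le_integral {F : ℝ → ℝ} (hF : ContDiff ℝ 1 F) {ε : ℝ} (hε : 0 < ε) (x : ℝ) :
    ε * F x ^ 2 ≤ ∫ y in x..(x + ε), (2 * F y ^ 2 + 2 * ε ^ 2 * deriv F y ^ 2) := by
  have hd : Continuous (deriv F) := hF.continuous_deriv le_rfl
  have hle : x ≤ x + ε := by linarith
  set J := ∫ y in x..(x + ε), deriv F y ^ 2 with hJ
  have hint : ∀ a b, IntervalIntegrable (fun y => deriv F y ^ 2) volume a b := fun a b =>
    (hd.pow 2).intervalIntegrable a b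
  have hpt : ∀ y ∈ Icc x (x + ε), F x ^ 2 ≤ 2 * F y ^ 2 + 2 * (ε * J) := by
    intro y hy
    have h1 : ∫ z in x..y, deriv F z = F y - F x :=
      intervalIntegral.integral_deriv_eq_sub (fun z _ => hF.differentiable one_ne_zero z)
        (hd.intervalIntegrable _ _)
    have h2 : (F y - F x) ^ 2 ≤ ε * J := by
      rw [← h1]
      refine (sq_intervalIntegral_le hd hy.1).trans ?_
      have h4 : ∫ z in x..y, deriv F z ^ 2 ≤ J :=
        intervalIntegral.integral_mono_interval le_rfl hy.1 hy.2
          (Eventually.of_forall fun z => sq_nonneg _) (hint _ _)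
      have h5 : 0 ≤ ∫ z in x..y, deriv F z ^ 2 :=
        intervalIntegral.integral_nonneg hy.1 fun z _ => sq_nonneg _
      exact mul_le_mul (by linarith [hy.2]) h4 h5 hε.le
    nlinarith [sq_nonneg (F x - 2 * F y), sq_nonneg (2 * F y - F x)]
  have h3 : ∫ _ in x..(x + ε), F x ^ 2 ≤ ∫ y in x..(x + ε), (2 * F y ^ 2 + 2 * (ε * J)) :=
    intervalIntegral.integral_mono_on hle (by simp)
      (((continuous_const.mul (hF.continuous.pow 2)).add continuous_const).intervalIntegrable _ _)
      hpt
  have i1 : IntervalIntegrable (fun y => 2 * F y ^ 2) volume x (x + ε) :=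
    (continuous_const.mul (hF.continuous.pow 2)).intervalIntegrable _ _
  rw [intervalIntegral.integral_const, intervalIntegral.integral_add i1 (by simp),
    intervalIntegral.integral_const] at h3
  rw [intervalIntegral.integral_add i1 ((hint _ _).const_mul _),
    intervalIntegral.integral_const_mul (2 * ε ^ 2)]
  simp only [add_sub_cancel_left, smul_eq_mul] at h3
  calc _ ≤ _ := h3
    _ = _ := by rw [← hJ]; ring

/-- Sampling on the grid `ε ℤ + s` costs `ε^{-1/2}` times an `H¹` norm. -/
theorem ellTwoNorm_sample_le {F : ℝ → ℝ} (hF : ContDiff ℝ 1 F) (h0 : MemLp F 2 volume)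
    (h1 : MemLp (deriv F) 2 volume) {ε : ℝ} (hε : 0 < ε) (hε1 : ε ≤ 1) (s : ℝ) :
    ellTwoNorm (fun j : ℤ => F (ε * j + s)) ≤
      ENNReal.ofReal (Real.sqrt (2 * ((∫ x, F x ^ 2) + ∫ x, deriv F x ^ 2)) / Real.sqrt ε) := by
  set g : ℝ → ℝ := fun y => 2 * F y ^ 2 + 2 * ε ^ 2 * deriv F y ^ 2 with hg
  have hg0 : ∀ y, 0 ≤ g y := fun y => by positivity
  have hgi : Integrable g := (h0.integrable_sq.const_mul 2).add (h1.integrable_sq.const_mul _)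
  set N := 2 * ((∫ x, F x ^ 2) + ∫ x, deriv F x ^ 2) with hN
  have hA : 0 ≤ ∫ x, F x ^ 2 := integral_nonneg fun _ => sq_nonneg _
  have hB : 0 ≤ ∫ x, deriv F x ^ 2 := integral_nonneg fun _ => sq_nonneg _
  have hN0 : 0 ≤ N := by positivity
  have hgN : ∫ y, g y ≤ N := by
    rw [hg, integral_add (h0.integrable_sq.const_mul 2) (h1.integrable_sq.const_mul _),
      integral_const_mul, integral_const_mul, hN]
    have : ε ^ 2 ≤ 1 := pow_le_one₀ hε.le hε1
    nlinarith
  have hcell : ∀ j : ℤ, ENNReal.ofReal ε * ‖F (ε * j + s)‖ₑ ^ 2 ≤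
      ∫⁻ y in Ioc (s + j • ε) (s + (j + 1) • ε), ENNReal.ofReal (g y) := by
    intro j
    have e1 : s + j • ε = ε * j + s := by rw [zsmul_eq_mul]; ring
    have e2 : s + (j + 1) • ε = ε * j + s + ε := by rw [zsmul_eq_mul]; push_cast; ring
    rw [e1, e2, ← ofReal_integral_eq_lintegral_ofReal hgi.integrableOn
      (Eventually.of_forall hg0), ← intervalIntegral.integral_of_le (by linarith), ← ofReal_norm,
      ← ENNReal.ofReal_pow (norm_nonneg _), ← ENNReal.ofReal_mul hε.le, Real.norm_eq_abs, sq_abs]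
    exact ENNReal.ofReal_le_ofReal (mul_sq_le_integral hF hε _)
  have hsum : ENNReal.ofReal ε * ellTwoNorm (fun j : ℤ => F (ε * j + s)) ^ 2 ≤
      ENNReal.ofReal N := by
    rw [ellTwoNorm_sq, ← ENNReal.tsum_mul_left]
    calc _ ≤ ∑' j : ℤ, ∫⁻ y in Ioc (s + j • ε) (s + (j + 1) • ε), ENNReal.ofReal (g y) :=
          ENNReal.tsum_le_tsum hcell
      _ = ∫⁻ y in ⋃ j : ℤ, Ioc (s + j • ε) (s + (j + 1) • ε), ENNReal.ofReal (g y) :=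
          (lintegral_iUnion (fun _ => measurableSet_Ioc)
            (Set.pairwise_disjoint_Ioc_add_zsmul s ε) _).symm
      _ ≤ ∫⁻ y, ENNReal.ofReal (g y) := setLIntegral_le_lintegral _ _
      _ = ENNReal.ofReal (∫ y, g y) :=
          (ofReal_integral_eq_lintegral_ofReal hgi (Eventually.of_forall hg0)).symm
      _ ≤ _ := ENNReal.ofReal_le_ofReal hgN
  have hsq : ellTwoNorm (fun j : ℤ => F (ε * j + s)) ^ 2 ≤
      ENNReal.ofReal (Real.sqrt N / Real.sqrt ε) ^ 2 := by
    rw [← ENNReal.ofReal_pow (by positivity), div_pow, Real.sq_sqrt hN0, Real.sq_sqrt hε.le,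
      ENNReal.ofReal_div_of_pos hε]
    rw [ENNReal.le_div_iff_mul_le (Or.inl (by simpa using hε)) (Or.inl ENNReal.ofReal_ne_top),
      mul_comm]
    exact hsum
  exact (ENNReal.pow_right_strictMono two_ne_zero).le_iff_le.1 hsq

/-- Truncation: a `C²` function in `H¹` is approximated in `H¹`, hence in the sampled norm,
by compactly supported `C²` functions. -/
theorem exists_compactSupport_sample_approx {F : ℝ → ℝ} (hF : ContDiff ℝ 2 F)
    (h0 : MemLp F 2 volume) (h1 : MemLp (deriv F) 2 volume) {η : ℝ} (hη : 0 < η) :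
    ∃ f : ℝ → ℝ, ContDiff ℝ 2 f ∧ HasCompactSupport f ∧
      ∀ ε : ℝ, 0 < ε → ε ≤ 1 → ∀ s : ℝ,
        ellTwoNorm (fun j : ℤ => F (ε * j + s) - f (ε * j + s)) ≤
          ENNReal.ofReal (η / Real.sqrt ε) := by
  let χ : ContDiffBump (0 : ℝ) := ⟨1, 2, one_pos, by norm_num⟩
  have hχs : ContDiff ℝ 2 χ := χ.contDiff
  have hF1 : ContDiff ℝ 1 F := hF.of_le (by norm_num)
  obtain ⟨M, hM⟩ := (hχs.continuous_deriv (by norm_num)).bounded_above_of_compact_support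
    χ.hasCompactSupport.deriv
  have hM0 : 0 ≤ M := (norm_nonneg _).trans (hM 0)
  set ν : ℕ → ℝ := fun n => 1 / ((n : ℝ) + 1) with hν
  have ν0 : ∀ n, 0 < ν n := fun n => Nat.one_div_pos_of_nat
  have ν1 : ∀ n, ν n ≤ 1 := fun n => by
    rw [hν, div_le_one (by positivity)]; linarith [n.cast_nonneg (α := ℝ)]
  have νlim : Tendsto ν atTop (𝓝 0) := tendsto_one_div_add_atTop_nhds_zero_nat
  set f : ℕ → ℝ → ℝ := fun n x => χ (ν n * x) * F x with hfdef
  have hf2 : ∀ n, ContDiff ℝ 2 (f n) := fun n =>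
    (hχs.comp (contDiff_const.mul contDiff_id)).mul hF
  have hfc : ∀ n, HasCompactSupport (f n) := fun n => by
    refine HasCompactSupport.intro (isCompact_Icc (a := -(2 / ν n)) (b := 2 / ν n)) fun x hx => ?_
    rw [mem_Icc, ← abs_le, not_le, div_lt_iff₀ (ν0 n)] at hx
    have : χ (ν n * x) = 0 := χ.zero_of_le_dist (by
      change 2 ≤ _
      rw [dist_zero_right, norm_mul, Real.norm_of_nonneg (ν0 n).le, Real.norm_eq_abs]
      linarith)
    simp only [hfdef, this, zero_mul]
  set D : ℕ → ℝ → ℝ := fun n x => F x - f n x with hD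
  have hDs : ∀ n, ContDiff ℝ 1 (D n) := fun n => hF1.sub ((hf2 n).of_le (by norm_num))
  have hDd : ∀ n x, deriv (D n) x =
      (1 - χ (ν n * x)) * deriv F x - ν n * deriv χ (ν n * x) * F x := by
    intro n x
    have dχ : HasDerivAt (fun x => χ (ν n * x)) (deriv χ (ν n * x) * (ν n * 1)) x :=
      HasDerivAt.comp x (h₂ := χ) ((hχs.differentiable (by norm_num) _).hasDerivAt)
        ((hasDerivAt_id x).const_mul (ν n))
    have dF := (hF1.differentiable one_ne_zero x).hasDerivAt
    refine (dF.sub (dχ.mul dF)).deriv.trans ?_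
    ring
  have hχ01 : ∀ n x, |1 - χ (ν n * x)| ≤ 1 := fun n x => by
    rw [abs_of_nonneg (sub_nonneg.2 χ.le_one)]; linarith [χ.nonneg (x := ν n * x)]
  have bD : ∀ n x, ‖D n x‖ ≤ ‖F x‖ := fun n x => by
    have : D n x = (1 - χ (ν n * x)) * F x := by simp only [hD, hfdef]; ring
    rw [this, norm_mul]
    exact mul_le_of_le_one_left (norm_nonneg _) (hχ01 n x)
  have bD' : ∀ n x, ‖deriv (D n) x‖ ≤ ‖|deriv F x| + M * |F x|‖ := fun n x => by
    rw [hDd, Real.norm_eq_abs, Real.norm_of_nonneg (by positivity)]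
    refine (abs_sub _ _).trans (add_le_add ?_ ?_)
    · rw [abs_mul]
      exact mul_le_of_le_one_left (abs_nonneg _) (hχ01 n x)
    · rw [abs_mul, abs_mul, abs_of_pos (ν0 n)]
      refine mul_le_mul_of_nonneg_right ?_ (abs_nonneg _)
      exact (mul_le_of_le_one_left (abs_nonneg _) (ν1 n)).trans (hM _)
  have hbound : MemLp (fun x => |deriv F x| + M * |F x|) 2 volume := h1.abs.add (h0.abs.const_mul M)
  have hDL : ∀ n, MemLp (D n) 2 volume := fun n =>
    h0.mono (hDs n).continuous.aestronglyMeasurable (Eventually.of_forall (bD n))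
  have hDL' : ∀ n, MemLp (deriv (D n)) 2 volume := fun n =>
    hbound.mono ((hDs n).continuous_deriv le_rfl).aestronglyMeasurable
      (Eventually.of_forall (bD' n))
  have hone : ∀ x, ∀ᶠ n in atTop, χ (ν n * x) = 1 := fun x => by
    have : Tendsto (fun n => |ν n * x|) atTop (𝓝 |0 * x|) := (νlim.mul_const x).abs
    rw [zero_mul, abs_zero] at this
    filter_upwards [this.eventually_lt_const one_pos] with n hn
    refine χ.one_of_mem_closedBall ?_
    rw [mem_closedBall_zero_iff]
    exact hn.le
  have hzero : ∀ x, ∀ᶠ n in atTop, D n x = 0 := fun x => by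
    filter_upwards [hone x] with n hn
    simp [hD, hfdef, hn]
  have lim0 : Tendsto (fun n => ∫ x, D n x ^ 2) atTop (𝓝 (∫ _ : ℝ, (0 : ℝ))) := by
    refine tendsto_integral_of_dominated_convergence (fun x => F x ^ 2)
      (fun n => ((hDs n).continuous.pow 2).aestronglyMeasurable) h0.integrable_sq
      (fun n => Eventually.of_forall fun x => ?_) (Eventually.of_forall fun x => ?_)
    · rw [norm_pow, ← sq_abs (F x)]
      exact pow_le_pow_left₀ (norm_nonneg _) (bD n x) 2
    · refine tendsto_const_nhds.congr' ?_
      filter_upwards [hzero x] with n hn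
      rw [hn]; norm_num
  have lim1 : Tendsto (fun n => ∫ x, deriv (D n) x ^ 2) atTop (𝓝 (∫ _ : ℝ, (0 : ℝ))) := by
    refine tendsto_integral_of_dominated_convergence (fun x => (|deriv F x| + M * |F x|) ^ 2)
      (fun n => (((hDs n).continuous_deriv le_rfl).pow 2).aestronglyMeasurable)
      hbound.integrable_sq
      (fun n => Eventually.of_forall fun x => ?_) (Eventually.of_forall fun x => ?_)
    · rw [norm_pow]
      refine (pow_le_pow_left₀ (norm_nonneg _) (bD' n x) 2).trans (le_of_eq ?_)
      rw [Real.norm_eq_abs, sq_abs]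
    · have l1 : Tendsto (fun n => M * |F x| * ν n) atTop (𝓝 (M * |F x| * 0)) :=
        νlim.const_mul _
      rw [mul_zero] at l1
      have l2 : Tendsto (fun n => deriv (D n) x) atTop (𝓝 0) := by
        refine squeeze_zero_norm' ?_ l1
        filter_upwards [hone x] with n hn
        rw [hDd, hn, sub_self, zero_mul, zero_sub, norm_neg, norm_mul, norm_mul,
          Real.norm_of_nonneg (ν0 n).le, Real.norm_eq_abs (F x)]
        have := mul_le_mul_of_nonneg_right (hM (ν n * x)) (abs_nonneg (F x))
        nlinarith [ν0 n]
      simpa using l2.pow 2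
  have lim : Tendsto (fun n => Real.sqrt (2 * ((∫ x, D n x ^ 2) + ∫ x, deriv (D n) x ^ 2))) atTop
      (𝓝 0) := by
    have := ((lim0.add lim1).const_mul 2).sqrt
    simpa using this
  obtain ⟨n, hn⟩ := (lim.eventually_lt_const hη).exists
  refine ⟨f n, hf2 n, hfc n, fun ε hε hε1 s => ?_⟩
  refine (ellTwoNorm_sample_le (hDs n) (hDL n) (hDL' n) hε hε1 s).trans
    (ENNReal.ofReal_le_ofReal ?_)
  gcongr

/-! ### Correctors from the strong law of large numbers -/

theorem exists_abs_le_mul_add_of_tendsto_div {u : ℕ → ℝ}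
    (hu : Tendsto (fun n : ℕ => u n / n) atTop (𝓝 0)) {η : ℝ} (hη : 0 < η) :
    ∃ C : ℝ, 0 ≤ C ∧ ∀ n : ℕ, |u n| ≤ η * n + C := by
  obtain ⟨N, hN⟩ := eventually_atTop.1 (hu.abs.eventually_lt_const (by simpa using hη))
  refine ⟨∑ i ∈ Finset.range (N + 1), |u i|, Finset.sum_nonneg fun _ _ => abs_nonneg _,
    fun n => ?_⟩
  rcases lt_or_ge n (N + 1) with h | h
  · have := Finset.single_le_sum (f := fun i => |u i|) (fun _ _ => abs_nonneg _)
      (Finset.mem_range.2 h)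
    have h2 : 0 ≤ η * n := by positivity
    beta_reduce at this
    linarith
  · have hn : (0 : ℝ) < n := by exact_mod_cast (Nat.succ_pos N).trans_le h
    have h1 := hN n (by omega)
    rw [abs_div, abs_of_pos hn, div_lt_iff₀ hn] at h1
    have : 0 ≤ ∑ i ∈ Finset.range (N + 1), |u i| := Finset.sum_nonneg fun _ _ => abs_nonneg _
    linarith

theorem Sublinear.shift {χ : ℤ → ℝ} (hχ : Sublinear χ) : Sublinear fun j => χ (j + 1) := by
  intro η hη
  obtain ⟨C, hC⟩ := hχ η hη
  refine ⟨C + η, fun j => (hC (j + 1)).trans ?_⟩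
  have : |((j + 1 : ℤ) : ℝ)| ≤ |(j : ℝ)| + 1 := by
    push_cast
    exact (abs_add_le _ _).trans (by simp)
  nlinarith

/-- A two-sided sequence whose averages vanish in both directions has a sublinear primitive. -/
theorem exists_sublinear_primitive {d : ℤ → ℝ}
    (h₁ : Tendsto (fun n : ℕ => (∑ i ∈ Finset.range n, d i) / n) atTop (𝓝 0))
    (h₂ : Tendsto (fun n : ℕ => (∑ i ∈ Finset.range n, d (-1 - i)) / n) atTop (𝓝 0)) :
    ∃ χ : ℤ → ℝ, (∀ j, χ (j + 1) - χ j = d j) ∧ Sublinear χ := by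
  refine ⟨fun j => ∑ i ∈ Finset.range j.toNat, d i - ∑ i ∈ Finset.range (-j).toNat, d (-1 - i),
    fun j => ?_, fun η hη => ?_⟩
  · beta_reduce
    rcases le_or_gt 0 j with h | h
    · obtain ⟨n, rfl⟩ := Int.eq_ofNat_of_zero_le h
      rw [show ((n : ℤ) + 1).toNat = n + 1 by omega, show (-((n : ℤ) + 1)).toNat = 0 by omega,
        show (n : ℤ).toNat = n by omega, show (-(n : ℤ)).toNat = 0 by omega,
        Finset.sum_range_succ]
      ring
    · obtain ⟨n, hn⟩ : ∃ n : ℕ, j = -1 - n := ⟨(-1 - j).toNat, by omega⟩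
      subst hn
      rw [show ((-1 - (n : ℤ)) + 1).toNat = 0 by omega,
        show (-((-1 - (n : ℤ)) + 1)).toNat = n by omega,
        show (-1 - (n : ℤ)).toNat = 0 by omega, show (-(-1 - (n : ℤ))).toNat = n + 1 by omega,
        Finset.sum_range_succ]
      ring
  · obtain ⟨C₁, p₁, b₁⟩ := exists_abs_le_mul_add_of_tendsto_div h₁ hη
    obtain ⟨C₂, p₂, b₂⟩ := exists_abs_le_mul_add_of_tendsto_div h₂ hη
    refine ⟨C₁ + C₂, fun j => (abs_sub _ _).trans ((add_le_add (b₁ _) (b₂ _)).trans ?_)⟩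
    have : ((j.toNat : ℝ)) + ((-j).toNat : ℝ) = |(j : ℝ)| := by
      have h : ((j.toNat : ℤ)) + ((-j).toNat : ℤ) = |j| := by
        rcases le_or_gt 0 j with h | h
        · rw [abs_of_nonneg h]; omega
        · rw [abs_of_neg h]; omega
      exact_mod_cast congrArg (Int.cast : ℤ → ℝ) h
    rw [← this]
    linarith

theorem IsIIDIn.integrable {Ω : Type*} [MeasurableSpace Ω] {μ : Measure Ω} [IsProbabilityMeasure μ]
    {X : ℤ → Ω → ℝ} {a b : ℝ} (h : IsIIDIn μ X a b) (j : ℤ) : Integrable (X j) μ :=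
  Integrable.of_mem_Icc a b (h.identDistrib j).aemeasurable_fst (h.mem_Icc j)

/-- Almost surely, the fluctuations of an i.i.d. bounded environment have a sublinear primitive. -/
theorem IsIIDIn.ae_exists_sublinear_primitive {Ω : Type*} [MeasurableSpace Ω] {μ : Measure Ω}
    [IsProbabilityMeasure μ] {X : ℤ → Ω → ℝ} {a b : ℝ} (h : IsIIDIn μ X a b) :
    ∀ᵐ ω ∂μ, ∃ χ : ℤ → ℝ, (∀ j, χ (j + 1) - χ j = X j ω - ∫ ω', X 0 ω' ∂μ) ∧ Sublinear χ := by
  have key : ∀ e : ℕ → ℤ, Function.Injective e → ∀ᵐ ω ∂μ,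
      Tendsto (fun n : ℕ => (∑ i ∈ Finset.range n, (X (e i) ω - ∫ ω', X 0 ω' ∂μ)) / n) atTop
        (𝓝 0) := by
    intro e he
    have hid : ∀ i, IdentDistrib (X (e i)) (X (e 0)) μ μ := fun i =>
      (h.identDistrib _).trans (h.identDistrib _).symm
    have := strong_law_ae_real (fun i => X (e i)) (h.integrable _)
      (fun i j hij => h.indep.indepFun (he.ne hij)) hid
    filter_upwards [this] with ω hω
    have hmean : ∫ ω', X (e 0) ω' ∂μ = ∫ ω', X 0 ω' ∂μ := (h.identDistrib (e 0)).integral_eq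
    rw [hmean] at hω
    have h1 := hω.sub_const (∫ ω', X 0 ω' ∂μ)
    rw [sub_self] at h1
    refine h1.congr' ?_
    filter_upwards [eventually_gt_atTop 0] with n hn
    have : (n : ℝ) ≠ 0 := by exact_mod_cast hn.ne'
    rw [Finset.sum_sub_distrib, Finset.sum_const, Finset.card_range, nsmul_eq_mul]
    field_simp
  filter_upwards [key (fun i => (i : ℤ)) Nat.cast_injective,
    key (fun i => -1 - (i : ℤ)) (fun i j hij => by simpa using hij)] with ω h₁ h₂
  exact exists_sublinear_primitive (d := fun j => X j ω - ∫ ω', X 0 ω' ∂μ) h₁ h₂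

/-! ### Lower bound for the effective wave -/

theorem le_ellTwoNorm_of_finset {f : ℤ → ℝ} {δ n : ℝ} (hδ : 0 ≤ δ) (hn : 0 ≤ n) (S : Finset ℤ)
    (hS : n ≤ S.card) (h : ∀ j ∈ S, δ ≤ |f j|) :
    ENNReal.ofReal (δ * Real.sqrt n) ≤ ellTwoNorm f := by
  have : ENNReal.ofReal (δ * Real.sqrt n) ^ 2 ≤ ellTwoNorm f ^ 2 := by
    rw [ellTwoNorm_sq, ← ENNReal.ofReal_pow (by positivity), mul_pow, Real.sq_sqrt hn]
    refine le_trans ?_ (ENNReal.sum_le_tsum S)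
    calc ENNReal.ofReal (δ ^ 2 * n) ≤ ENNReal.ofReal (S.card * δ ^ 2) := by
          refine ENNReal.ofReal_le_ofReal ?_
          rw [mul_comm]; gcongr
      _ = ∑ j ∈ S, ENNReal.ofReal (δ ^ 2) := by
          rw [Finset.sum_const, nsmul_eq_mul, ENNReal.ofReal_mul (by positivity),
            ENNReal.ofReal_natCast]
      _ ≤ ∑ j ∈ S, ‖f j‖ₑ ^ 2 := by
          refine Finset.sum_le_sum fun j hj => ?_
          rw [← ofReal_norm, ← ENNReal.ofReal_pow (norm_nonneg _)]
          exact ENNReal.ofReal_le_ofReal (pow_le_pow_left₀ hδ (h j hj) 2)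
  exact (ENNReal.pow_right_strictMono two_ne_zero).le_iff_le.1 this

/-- If a continuous function does not vanish identically on any time slice, its sampled norm on
each slice is at least of order `ε^{-1/2}`, uniformly on compact time intervals. -/
theorem exists_le_ellTwoNorm_sample {Q : ℝ → ℝ → ℝ} (hQ : Continuous fun z : ℝ × ℝ => Q z.1 z.2)
    {T₀ : ℝ} (h : ∀ τ ∈ Icc (-T₀) T₀, ∃ X, Q X τ ≠ 0) :
    ∃ κ > 0, ∀ᶠ ε : ℝ in 𝓝[>] 0, ∀ τ ∈ Icc (-T₀) T₀,
      ENNReal.ofReal (κ / Real.sqrt ε) ≤ ellTwoNorm (fun j : ℤ => Q (ε * j) τ) := by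
  refine (isCompact_Icc (a := -T₀) (b := T₀)).induction_on
    (p := fun s => ∃ κ > 0, ∀ᶠ ε : ℝ in 𝓝[>] 0, ∀ τ ∈ s,
      ENNReal.ofReal (κ / Real.sqrt ε) ≤ ellTwoNorm (fun j : ℤ => Q (ε * j) τ))
    ⟨1, one_pos, Eventually.of_forall fun _ _ h => absurd h (notMem_empty _)⟩ ?_ ?_ ?_
  · rintro s t hst ⟨κ, hκ, H⟩
    exact ⟨κ, hκ, H.mono fun ε hε τ hτ => hε τ (hst hτ)⟩
  · rintro s t ⟨κ₁, hκ₁, H₁⟩ ⟨κ₂, hκ₂, H₂⟩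
    refine ⟨min κ₁ κ₂, lt_min hκ₁ hκ₂, ?_⟩
    filter_upwards [H₁, H₂] with ε h₁ h₂ τ hτ
    rcases hτ with hτ | hτ
    · refine le_trans (ENNReal.ofReal_le_ofReal ?_) (h₁ τ hτ)
      gcongr; exact min_le_left _ _
    · refine le_trans (ENNReal.ofReal_le_ofReal ?_) (h₂ τ hτ)
      gcongr; exact min_le_right _ _
  · intro τ₀ hτ₀
    obtain ⟨X, hX⟩ := h τ₀ hτ₀
    set δ := |Q X τ₀| / 2 with hδdef
    have hδ : 0 < δ := half_pos (abs_pos.2 hX)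
    have hev : ∀ᶠ z : ℝ × ℝ in 𝓝 (X, τ₀), δ < |Q z.1 z.2| :=
      hQ.abs.continuousAt.eventually_const_lt (half_lt_self (abs_pos.2 hX))
    obtain ⟨a, ha, hball⟩ := Metric.eventually_nhds_iff.1 hev
    refine ⟨Metric.ball τ₀ a, mem_nhdsWithin_of_mem_nhds (Metric.ball_mem_nhds _ ha),
      δ * Real.sqrt (a / 4), by positivity, ?_⟩
    filter_upwards [Ioo_mem_nhdsGT (show (0 : ℝ) < a / 4 by positivity)] with ε hε τ hτ
    have hε0 : 0 < ε := hε.1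
    have e : δ * Real.sqrt (a / 4) / Real.sqrt ε = δ * Real.sqrt (a / 4 / ε) := by
      rw [Real.sqrt_div (show 0 ≤ a / 4 by positivity) ε, mul_div_assoc]
    rw [e]
    -- The grid points in `[X, X + a / 2]`.
    refine le_ellTwoNorm_of_finset hδ.le (by positivity)
      (Finset.Icc ⌈X / ε⌉ ⌊(X + a / 2) / ε⌋) ?_ fun j hj => ?_
    · rw [Int.card_Icc]
      have h1 : (((⌊(X + a / 2) / ε⌋ + 1 - ⌈X / ε⌉ : ℤ)) : ℝ) ≤
          ((⌊(X + a / 2) / ε⌋ + 1 - ⌈X / ε⌉).toNat : ℝ) := by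
        exact_mod_cast Int.self_le_toNat _
      refine le_trans ?_ h1
      push_cast
      have h2 := Int.lt_floor_add_one ((X + a / 2) / ε)
      have h3 := Int.ceil_lt_add_one (X / ε)
      have h4 : (X + a / 2) / ε = X / ε + 2 * (a / 4 / ε) := by field_simp; ring
      have h5 : 1 ≤ a / 4 / ε := by rw [le_div_iff₀ hε0]; linarith [hε.2]
      linarith
    · rw [Finset.mem_Icc, Int.ceil_le, Int.le_floor, div_le_iff₀ hε0, le_div_iff₀ hε0] at hj
      refine (hball (y := (ε * j, τ)) ?_).le
      rw [Prod.dist_eq, max_lt_iff]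
      refine ⟨?_, hτ⟩
      rw [Real.dist_eq, abs_lt]
      constructor <;> linarith [hj.1, hj.2, mul_comm ε (j : ℝ)]

/-! ### Comparison of the lattice solution with the effective wave -/

theorem waveSpeed_pos {kt mb : ℝ} (hkt : 0 < kt) (hmb : 0 < mb) : 0 < waveSpeed kt mb :=
  Real.sqrt_pos.2 (div_pos hkt hmb)

theorem waveSpeed_sq_mul {kt mb : ℝ} (hkt : 0 < kt) (hmb : 0 < mb) :
    waveSpeed kt mb ^ 2 * mb = kt := by
  rw [waveSpeed, Real.sq_sqrt (by positivity)]
  field_simp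

theorem waveSpeed_mul {kt mb : ℝ} (hkt : 0 < kt) (hmb : 0 < mb) :
    waveSpeed kt mb * mb = Real.sqrt (kt * mb) := by
  have h : kt * mb = (waveSpeed kt mb * mb) ^ 2 := by
    rw [mul_pow, sq mb, ← mul_assoc, waveSpeed_sq_mul hkt hmb]
  rw [h, Real.sqrt_sq (mul_nonneg (waveSpeed_pos hkt hmb).le hmb.le)]

/-- The lattice solution stays within `o(ε^{-1/2})` of the effective wave in `ℓ²`, uniformly for
`|t| ≤ T₀ / ε`. The profiles are truncated, the truncated waves are corrected, and the difference
to the exact solution is controlled by the energy estimate. -/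
theorem eventually_error_le {m k χm χk : ℤ → ℝ} {c C kt mb : ℝ} (hc : 0 < c)
    (hm : ∀ j, m j ∈ Icc c C) (hk : ∀ j, k j ∈ Icc c C) (hkt : 0 < kt) (hmb : 0 < mb)
    (hχm : ∀ j, χm j - χm (j - 1) = m j - mb) (hχk : ∀ j, χk (j + 1) - χk j = 1 / k j - 1 / kt)
    (hsm : Sublinear χm) (hsk : Sublinear χk) {Φ Ψ : ℝ → ℝ} (hΦ : MemHLIL 3 Φ) (hΨ : MemHLIL 3 Ψ)
    {T₀ : ℝ} (hT₀ : 0 < T₀) {r p : ℝ → ℝ → EllTwo}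
    (hrp : ∀ ε ∈ Ioo (0 : ℝ) (1 / 2), IsLatticeSolution m k (r ε) (p ε) ∧
      (∀ j : ℤ, r ε 0 j = Φ (ε * j) / k j) ∧ (∀ j : ℤ, p ε 0 j = Ψ (ε * j)))
    {η : ℝ} (hη : 0 < η) :
    ∀ᶠ ε : ℝ in 𝓝[>] 0, ∀ t ∈ Icc (-(T₀ / ε)) (T₀ / ε),
      ellTwoNorm (fun j => r ε t j - 1 / k j * waveQ kt mb Φ Ψ (ε * j) (ε * t)) ≤
        ENNReal.ofReal (η / Real.sqrt ε) ∧
      ellTwoNorm (fun j => p ε t j - waveP kt mb Φ Ψ (ε * j) (ε * t)) ≤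
        ENNReal.ofReal (η / Real.sqrt ε) := by
  obtain ⟨D, hD, energy⟩ := norm_le_of_residual hc hm hk
  obtain ⟨Φs, Φ0, Φ1⟩ := hΦ.regularity
  obtain ⟨Ψs, Ψ0, Ψ1⟩ := hΨ.regularity
  set σ := waveSpeed kt mb with hσdef
  have hσ : 0 < σ := waveSpeed_pos hkt hmb
  have hσ2 : σ ^ 2 * mb = kt := waveSpeed_sq_mul hkt hmb
  have hZ : Real.sqrt (kt * mb) = σ * mb := (waveSpeed_mul hkt hmb).symm
  set A := profileA kt mb Φ Ψ with hA
  set B := profileB kt mb Φ Ψ with hB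
  have regular : ∀ z : ℝ, ContDiff ℝ 2 (fun x => 1 / 2 * Φ x + z * Ψ x) ∧
      MemLp (fun x => 1 / 2 * Φ x + z * Ψ x) 2 volume ∧
      MemLp (deriv (fun x => 1 / 2 * Φ x + z * Ψ x)) 2 volume := by
    intro z
    refine ⟨(contDiff_const.mul Φs).add (contDiff_const.mul Ψs),
      (Φ0.const_mul (1 / 2)).add (Ψ0.const_mul z), ?_⟩
    have e : deriv (fun x => 1 / 2 * Φ x + z * Ψ x) =
        fun x => 1 / 2 * deriv Φ x + z * deriv Ψ x := funext fun x =>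
      (((Φs.differentiable (by norm_num) x).hasDerivAt.const_mul (1 / 2)).add
        ((Ψs.differentiable (by norm_num) x).hasDerivAt.const_mul z)).deriv
    rw [e]
    exact (Φ1.const_mul (1 / 2)).add (Ψ1.const_mul z)
  have eA : A = fun x => 1 / 2 * Φ x + -(σ * mb / 2) * Ψ x := by
    funext x; rw [hA, profileA, hZ]; ring
  have eB : B = fun x => 1 / 2 * Φ x + σ * mb / 2 * Ψ x := by
    funext x; rw [hB, profileB, hZ]
  obtain ⟨As, A0, A1⟩ := regular (-(σ * mb / 2))
  obtain ⟨Bs, B0, B1⟩ := regular (σ * mb / 2)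
  rw [← eA] at As A0 A1
  rw [← eB] at Bs B0 B1
  -- `c₁` and `c₂` bound the distances of the corrected truncated wave to the effective wave.
  set c₁ : ℝ := 2 + 1 / c * 2 with hc₁
  set c₂ : ℝ := 2 + 1 / (σ * mb) * 2 with hc₂
  have c₁p : 0 < c₁ := by positivity
  have c₂p : 0 < c₂ := by positivity
  set θ : ℝ := η / (D * (c₁ + c₂ + 2 * T₀) + c₁ + c₂) with hθdef
  have hθ : 0 < θ := by positivity
  have hθη : D * (c₁ * θ + c₂ * θ + 2 * θ * T₀) + c₁ * θ + c₂ * θ = η := by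
    have : θ * (D * (c₁ + c₂ + 2 * T₀) + c₁ + c₂) = η := div_mul_cancel₀ _ (by positivity)
    rw [← this]; ring
  obtain ⟨a, as, ac, aA⟩ := exists_compactSupport_sample_approx As A0 A1 hθ
  obtain ⟨b, bs, bc, bB⟩ := exists_compactSupport_sample_approx Bs B0 B1 hθ
  filter_upwards [Ioo_mem_nhdsGT (show (0 : ℝ) < 1 / 2 by norm_num),
    exists_approximate_wave hc hm hk hmb (neg_ne_zero.2 hσ.ne') (by rw [neg_sq, hσ2]) hχm hχk
      hsm hsk as ac hT₀ hθ,
    exists_approximate_wave hc hm hk hmb hσ.ne' hσ2 hχm hχk hsm hsk bs bc hT₀ hθ]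
    with ε hε ⟨Ra, Pa, Ra', Pa', dRa, dPa, wa⟩ ⟨Rb, Pb, Rb', Pb', dRb, dPb, wb⟩
  have hε0 : 0 < ε := hε.1
  have hε1 : ε ≤ 1 := by linarith [hε.2]
  have hsε : 0 < Real.sqrt ε := Real.sqrt_pos.2 hε0
  obtain ⟨sol, r0, p0⟩ := hrp ε hε
  have kc : ∀ j, |1 / k j| ≤ 1 / c := fun j => by
    rw [abs_of_pos (one_div_pos.2 (hc.trans_le (hk j).1))]
    exact one_div_le_one_div_of_le hc (hk j).1
  set I := Icc (-(T₀ / ε)) (T₀ / ε) with hI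
  have hTε : 0 < T₀ / ε := div_pos hT₀ hε0
  have wQ : ∀ t (j : ℤ), waveQ kt mb Φ Ψ (ε * j) (ε * t) =
      A (ε * j + -σ * (ε * t)) + B (ε * j + σ * (ε * t)) := fun t j => by
    rw [waveQ, ← hσdef, ← hA, ← hB]; congr 2; ring
  have wP : ∀ t (j : ℤ), waveP kt mb Φ Ψ (ε * j) (ε * t) = 1 / (σ * mb) *
      (-A (ε * j + -σ * (ε * t)) + B (ε * j + σ * (ε * t))) := fun t j => by
    rw [waveP, ← hσdef, ← hA, ← hB, hZ]; congr 4; ring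
  have errQ : ∀ t ∈ I, ellTwoNorm (fun j => Ra t j + Rb t j -
      1 / k j * waveQ kt mb Φ Ψ (ε * j) (ε * t)) ≤ ENNReal.ofReal (c₁ * θ / Real.sqrt ε) := by
    intro t ht
    have h1 := ellTwoNorm_le_of_add (by positivity) (by positivity) (wa t ht).2.2.1
      (wb t ht).2.2.1 (fun j => rfl)
    have h2 := ellTwoNorm_le_of_add (by positivity) (by positivity)
      (aA ε hε0 hε1 (-σ * (ε * t))) (bB ε hε0 hε1 (σ * (ε * t))) (fun j => rfl)
    have h3 := ellTwoNorm_le_of_mul (w := fun j => -(1 / k j)) (C := 1 / c) (by positivity) h2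
      (fun j => by rw [abs_neg]; exact kc j) (fun j => rfl)
    have h4 := ellTwoNorm_le_of_add (f := fun j => Ra t j + Rb t j -
      1 / k j * waveQ kt mb Φ Ψ (ε * j) (ε * t)) (by positivity) (by positivity) h1 h3
      (fun j => by rw [wQ]; ring)
    refine h4.trans (le_of_eq ?_)
    rw [hc₁]; congr 1; ring
  have errP : ∀ t ∈ I, ellTwoNorm (fun j => Pa t j + Pb t j -
      waveP kt mb Φ Ψ (ε * j) (ε * t)) ≤ ENNReal.ofReal (c₂ * θ / Real.sqrt ε) := by
    intro t ht
    have h1 := ellTwoNorm_le_of_add (by positivity) (by positivity) (wa t ht).2.2.2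
      (wb t ht).2.2.2 (fun j => rfl)
    have h2' := bB ε hε0 hε1 (σ * (ε * t))
    rw [← ellTwoNorm_neg] at h2'
    have h2 := ellTwoNorm_le_of_add (by positivity) (by positivity)
      (aA ε hε0 hε1 (-σ * (ε * t))) h2' (fun j => rfl)
    have h3 := ellTwoNorm_le_of_mul (w := fun _ => 1 / (σ * mb)) (C := 1 / (σ * mb))
      (by positivity) h2 (fun j => by rw [abs_of_nonneg (by positivity)]) (fun j => rfl)
    have h4 := ellTwoNorm_le_of_add (f := fun j => Pa t j + Pb t j -
      waveP kt mb Φ Ψ (ε * j) (ε * t)) (by positivity) (by positivity) h1 h3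
      (fun j => by
        rw [wP, show -σ * mb = -(σ * mb) by ring, one_div_neg_eq_neg_one_div, Pi.neg_apply]; ring)
    refine h4.trans (le_of_eq ?_)
    rw [hc₂]; congr 1; ring
  set R : ℝ → EllTwo := fun t => r ε t - Ra t - Rb t with hR
  set P : ℝ → EllTwo := fun t => p ε t - Pa t - Pb t with hP
  have aR : ∀ t j, R t j = r ε t j - Ra t j - Rb t j := fun t j => rfl
  have aP : ∀ t j, P t j = p ε t j - Pa t j - Pb t j := fun t j => rfl
  have dR : ∀ t, HasDerivAt R (deriv (r ε) t - Ra' t - Rb' t) t := fun t =>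
    ((sol.differentiable_r t).hasDerivAt.sub (dRa t)).sub (dRb t)
  have dP : ∀ t, HasDerivAt P (deriv (p ε) t - Pa' t - Pb' t) t := fun t =>
    ((sol.differentiable_p t).hasDerivAt.sub (dPa t)).sub (dPb t)
  have h0 : (0 : ℝ) ∈ I := ⟨by linarith, hTε.le⟩
  have waveQ0 : ∀ X, waveQ kt mb Φ Ψ X 0 = Φ X := fun X => by
    simp only [waveQ, profileA, profileB, mul_zero, sub_zero, add_zero]; ring
  have waveP0 : ∀ X, waveP kt mb Φ Ψ X 0 = Ψ X := fun X => by
    have : σ * mb ≠ 0 := by positivity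
    simp only [waveP, profileA, profileB, mul_zero, sub_zero, add_zero, hZ]
    field_simp
    ring
  have nR0 : ‖R 0‖ ≤ c₁ * θ / Real.sqrt ε := by
    rw [← ENNReal.ofReal_le_ofReal_iff (by positivity), ← ellTwoNorm_coe]
    refine le_trans (ellTwoNorm_mono fun j => le_of_eq ?_) (errQ 0 h0)
    rw [aR, r0, mul_zero, waveQ0, ← abs_neg]
    congr 1; ring
  have nP0 : ‖P 0‖ ≤ c₂ * θ / Real.sqrt ε := by
    rw [← ENNReal.ofReal_le_ofReal_iff (by positivity), ← ellTwoNorm_coe]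
    refine le_trans (ellTwoNorm_mono fun j => le_of_eq ?_) (errP 0 h0)
    rw [aP, p0, mul_zero, waveP0, ← abs_neg]
    congr 1; ring
  have bound := energy R P _ _ (T₀ / ε) (2 * θ * Real.sqrt ε) hTε.le (by positivity) dR dP
    (fun t ht => by
      have h1 := ellTwoNorm_le_of_add (by positivity) (by positivity) (wa t ht).1 (wb t ht).1
        (fun j => rfl)
      rw [← ellTwoNorm_neg] at h1
      refine le_trans (ellTwoNorm_mono fun j => le_of_eq ?_) (h1.trans (le_of_eq ?_))
      · have e1 := sol.deriv_r t j
        have e2 : (deriv (r ε) t - Ra' t - Rb' t : EllTwo) j =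
          deriv (r ε) t j - Ra' t j - Rb' t j := rfl
        rw [e2, e1]
        simp only [deltaPlus, aP, Pi.neg_apply]
        congr 1; ring
      · congr 1; ring)
    (fun t ht => by
      have h1 := ellTwoNorm_le_of_add (by positivity) (by positivity) (wa t ht).2.1
        (wb t ht).2.1 (fun j => rfl)
      rw [← ellTwoNorm_neg] at h1
      refine le_trans (ellTwoNorm_mono fun j => le_of_eq ?_) (h1.trans (le_of_eq ?_))
      · have e1 := sol.deriv_p t j
        have e2 : (deriv (p ε) t - Pa' t - Pb' t : EllTwo) j =
          deriv (p ε) t j - Pa' t j - Pb' t j := rfl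
        have mj : m j ≠ 0 := (hc.trans_le (hm j).1).ne'
        rw [e2, e1]
        simp only [deltaMinus, aR, Pi.neg_apply]
        congr 1; field_simp; ring
      · congr 1; ring)
  have total : D * (‖R 0‖ + ‖P 0‖ + 2 * θ * Real.sqrt ε * (T₀ / ε)) ≤
      D * (c₁ * θ + c₂ * θ + 2 * θ * T₀) / Real.sqrt ε := by
    have e : 2 * θ * Real.sqrt ε * (T₀ / ε) = 2 * θ * T₀ / Real.sqrt ε := by
      rw [eq_div_iff hsε.ne']
      calc _ = 2 * θ * T₀ * ((Real.sqrt ε * Real.sqrt ε) / ε) := by ring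
        _ = _ := by rw [Real.mul_self_sqrt hε0.le, div_self hε0.ne', mul_one]
    rw [e, mul_div_assoc D, add_div, add_div]
    gcongr
  intro t ht
  obtain ⟨bR, bP⟩ := bound t ht
  have nR : ellTwoNorm (R t) ≤
      ENNReal.ofReal (D * (c₁ * θ + c₂ * θ + 2 * θ * T₀) / Real.sqrt ε) := by
    rw [ellTwoNorm_coe]; exact ENNReal.ofReal_le_ofReal (bR.trans total)
  have nP : ellTwoNorm (P t) ≤
      ENNReal.ofReal (D * (c₁ * θ + c₂ * θ + 2 * θ * T₀) / Real.sqrt ε) := by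
    rw [ellTwoNorm_coe]; exact ENNReal.ofReal_le_ofReal (bP.trans total)
  have q₁ : 0 ≤ c₁ * θ := by positivity
  have q₂ : 0 ≤ c₂ * θ := by positivity
  constructor
  · refine (ellTwoNorm_le_of_add (by positivity) (by positivity) nR (errQ t ht)
      (fun j => by rw [aR]; ring)).trans (ENNReal.ofReal_le_ofReal ?_)
    rw [← add_div]
    gcongr
    linarith
  · refine (ellTwoNorm_le_of_add (by positivity) (by positivity) nP (errP t ht)
      (fun j => by rw [aP]; ring)).trans (ENNReal.ofReal_le_ofReal ?_)
    rw [← add_div]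
    gcongr
    linarith

/-- An absolute error `o(ε^{-1/2})` is a vanishing relative error as soon as the approximation has
size at least of order `ε^{-1/2}`. -/
theorem tendsto_supRelError {T₀ κ : ℝ} (hκ : 0 < κ) {f g : ℝ → ℝ → ℤ → ℝ}
    (hfg : ∀ η > 0, ∀ᶠ ε : ℝ in 𝓝[>] 0, ∀ t ∈ Icc (-(T₀ / ε)) (T₀ / ε),
      ellTwoNorm (f ε t - g ε t) ≤ ENNReal.ofReal (η / Real.sqrt ε))
    (hg : ∀ᶠ ε : ℝ in 𝓝[>] 0, ∀ t ∈ Icc (-(T₀ / ε)) (T₀ / ε),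
      ENNReal.ofReal (κ / Real.sqrt ε) ≤ ellTwoNorm (g ε t)) :
    Tendsto (fun ε : ℝ => supRelError (T₀ / ε) (f ε) (g ε)) (𝓝[>] 0) (𝓝 0) := by
  rw [ENNReal.tendsto_nhds_zero]
  intro x hx
  obtain ⟨y, hy0, hyx⟩ : ∃ y : ℝ, 0 < y ∧ ENNReal.ofReal y ≤ x := by
    rcases eq_or_ne x ⊤ with rfl | h
    · exact ⟨1, one_pos, le_top⟩
    · exact ⟨x.toReal, ENNReal.toReal_pos hx.ne' h, ENNReal.ofReal_toReal_le⟩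
  set η : ℝ := min (κ / 2) (κ * y / 2) with hη
  have hη0 : 0 < η := lt_min (by positivity) (by positivity)
  filter_upwards [hfg η hη0, hg, self_mem_nhdsWithin] with ε h1 h2 hε
  have hsε : 0 < Real.sqrt ε := Real.sqrt_pos.2 hε
  refine iSup₂_le fun t ht => le_trans ?_ hyx
  have h1 := h1 t ht
  have h2 := h2 t ht
  have h3 : ENNReal.ofReal (κ / 2 / Real.sqrt ε) ≤ ellTwoNorm (f ε t) := by
    have h4 : ellTwoNorm (g ε t) ≤ ellTwoNorm (f ε t) + ellTwoNorm (f ε t - g ε t) := by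
      have := ellTwoNorm_sub_le (f ε t) (f ε t - g ε t)
      rwa [sub_sub_cancel] at this
    have h5 : ENNReal.ofReal (η / Real.sqrt ε) ≤ ENNReal.ofReal (κ / 2 / Real.sqrt ε) :=
      ENNReal.ofReal_le_ofReal (by gcongr; exact min_le_left _ _)
    have h6 : ENNReal.ofReal (κ / Real.sqrt ε) =
        ENNReal.ofReal (κ / 2 / Real.sqrt ε) + ENNReal.ofReal (κ / 2 / Real.sqrt ε) := by
      rw [← ENNReal.ofReal_add (by positivity) (by positivity)]; congr 1; ring
    rw [← ENNReal.add_le_add_iff_right (ENNReal.ofReal_ne_top (r := κ / 2 / Real.sqrt ε)), ← h6]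
    exact h2.trans (h4.trans (add_le_add le_rfl (h1.trans h5)))
  refine ENNReal.div_le_of_le_mul (h1.trans ?_)
  calc ENNReal.ofReal (η / Real.sqrt ε) ≤ ENNReal.ofReal (y * (κ / 2 / Real.sqrt ε)) := by
        refine ENNReal.ofReal_le_ofReal ?_
        rw [← mul_div_assoc]
        gcongr
        exact (min_le_right _ _).trans (le_of_eq (by ring))
    _ = ENNReal.ofReal y * ENNReal.ofReal (κ / 2 / Real.sqrt ε) := ENNReal.ofReal_mul hy0.le
    _ ≤ _ := by gcongr

theorem mul_mem_Icc_of_mem_Icc_div {T₀ ε t : ℝ} (hε : 0 < ε) (ht : t ∈ Icc (-(T₀ / ε)) (T₀ / ε)) :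
    ε * t ∈ Icc (-T₀) T₀ := by
  rw [← neg_div, mem_Icc, div_le_iff₀ hε, le_div_iff₀ hε] at ht
  exact ⟨by linarith [ht.1], by linarith [ht.2]⟩

end RandomLattice

theorem mainTheorem2 {Ω : Type*} [MeasurableSpace Ω] (μ : Measure Ω) [IsProbabilityMeasure μ]
    (m k : ℤ → Ω → ℝ) (am bm ak bk : ℝ) (ham : 0 < am) (hak : 0 < ak)
    (hm : RandomLattice.IsIIDIn μ m am bm)
    (hk : RandomLattice.IsIIDIn μ (fun j ω => 1 / k j ω) ak bk)
    (kt mb : ℝ) (hkt : kt = RandomLattice.effSpring μ k) (hmb : mb = RandomLattice.meanMass μ m)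
    (Φ Ψ : ℝ → ℝ) (hΦ : RandomLattice.MemHLIL 3 Φ) (hΨ : RandomLattice.MemHLIL 3 Ψ)
    (T₀ : ℝ) (hT₀ : 0 < T₀) :
    ∀ᵐ ω ∂μ, ∀ r p : ℝ → ℝ → RandomLattice.EllTwo,
      (∀ ε ∈ Ioo (0 : ℝ) (1 / 2),
        RandomLattice.IsLatticeSolution (fun j => m j ω) (fun j => k j ω) (r ε) (p ε) ∧
        (∀ j : ℤ, r ε 0 j = Φ (ε * j) / k j ω) ∧
        (∀ j : ℤ, p ε 0 j = Ψ (ε * j))) →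
      ((∀ τ ∈ Icc (-T₀) T₀, ∃ X, RandomLattice.waveQ kt mb Φ Ψ X τ ≠ 0) →
        Tendsto (fun ε : ℝ => RandomLattice.supRelError (T₀ / ε) (fun t j => r ε t j)
          (fun t j => 1 / k j ω * RandomLattice.waveQ kt mb Φ Ψ (ε * j) (ε * t)))
          (𝓝[>] 0) (𝓝 0)) ∧
      ((∀ τ ∈ Icc (-T₀) T₀, ∃ X, RandomLattice.waveP kt mb Φ Ψ X τ ≠ 0) →
        Tendsto (fun ε : ℝ => RandomLattice.supRelError (T₀ / ε) (fun t j => p ε t j)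
          (fun t j => RandomLattice.waveP kt mb Φ Ψ (ε * j) (ε * t)))
          (𝓝[>] 0) (𝓝 0)) := by
  have hI := hk.integrable 0
  have hmb0 : am ≤ mb := by
    rw [hmb, RandomLattice.meanMass]
    have := integral_mono_ae (integrable_const am) (hm.integrable 0)
      ((hm.mem_Icc 0).mono fun ω h => h.1)
    simpa using this
  have hk0 : ak ≤ ∫ ω, 1 / k 0 ω ∂μ := by
    have := integral_mono_ae (integrable_const ak) hI ((hk.mem_Icc 0).mono fun ω h => h.1)
    simpa using this
  have hmbp : 0 < mb := ham.trans_le hmb0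
  have hktp : 0 < kt := by
    rw [hkt]; exact one_div_pos.2 (hak.trans_le hk0)
  have hkt1 : 1 / kt = ∫ ω, 1 / k 0 ω ∂μ := by
    rw [hkt, RandomLattice.effSpring, one_div_one_div]
  have contA : Continuous (RandomLattice.profileA kt mb Φ Ψ) :=
    (continuous_const.mul hΦ.1).sub (continuous_const.mul hΨ.1)
  have contB : Continuous (RandomLattice.profileB kt mb Φ Ψ) :=
    (continuous_const.mul hΦ.1).add (continuous_const.mul hΨ.1)
  have cA : Continuous fun z : ℝ × ℝ => RandomLattice.profileA kt mb Φ Ψ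
      (z.1 - RandomLattice.waveSpeed kt mb * z.2) := contA.comp (by fun_prop)
  have cB : Continuous fun z : ℝ × ℝ => RandomLattice.profileB kt mb Φ Ψ
      (z.1 + RandomLattice.waveSpeed kt mb * z.2) := contB.comp (by fun_prop)
  filter_upwards [hm.ae_exists_sublinear_primitive, hk.ae_exists_sublinear_primitive,
    ae_all_iff.2 hm.mem_Icc, ae_all_iff.2 hk.mem_Icc] with ω hχm hχk bm' bk'
  obtain ⟨χm, em, sm⟩ := hχm
  obtain ⟨χk, ek, sk⟩ := hχk
  intro r p hrp
  have hbk : 0 < bk := hak.trans_le ((bk' 0).1.trans (bk' 0).2)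
  set c : ℝ := min am (1 / bk) with hc
  set C : ℝ := max bm (1 / ak) with hC
  have hc0 : 0 < c := lt_min ham (one_div_pos.2 hbk)
  have hmc : ∀ j, m j ω ∈ Icc c C := fun j =>
    ⟨(min_le_left _ _).trans (bm' j).1, (bm' j).2.trans (le_max_left _ _)⟩
  have hkc : ∀ j, k j ω ∈ Icc c C := fun j => by
    obtain ⟨h1, h2⟩ := bk' j
    have h3 : 0 < 1 / k j ω := hak.trans_le h1
    rw [← one_div_one_div (k j ω)]
    exact ⟨(min_le_right _ _).trans (one_div_le_one_div_of_le h3 h2),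
      (one_div_le_one_div_of_le hak h1).trans (le_max_right _ _)⟩
  have hC0 : 0 < C := hc0.trans_le ((hmc 0).1.trans (hmc 0).2)
  have main : ∀ η > (0 : ℝ), _ := fun η hη => RandomLattice.eventually_error_le (η := η) hc0 hmc hkc
    hktp hmbp (χm := fun j => χm (j + 1)) (χk := χk)
    (fun j => by rw [sub_add_cancel, em, hmb]; rfl) (fun j => by rw [ek, hkt1]) sm.shift sk
    hΦ hΨ hT₀ hrp hη
  constructor
  · intro hQ
    -- Multiplication by `1 / k ≥ 1 / C` is absorbed into the wave before the lower bound is used.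
    obtain ⟨κ, hκ, low⟩ := RandomLattice.exists_le_ellTwoNorm_sample
      (Q := fun X τ => 1 / C * RandomLattice.waveQ kt mb Φ Ψ X τ)
      (continuous_const.mul (cA.add cB)) (T₀ := T₀) fun τ hτ => by
        obtain ⟨X, hX⟩ := hQ τ hτ
        exact ⟨X, mul_ne_zero (one_div_pos.2 hC0).ne' hX⟩
    refine RandomLattice.tendsto_supRelError hκ (f := fun ε t j => r ε t j)
      (g := fun ε t j => 1 / k j ω * RandomLattice.waveQ kt mb Φ Ψ (ε * j) (ε * t))
      (fun η hη => (main η hη).mono fun ε h t ht => (h t ht).1) ?_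
    filter_upwards [low, self_mem_nhdsWithin] with ε h hε t ht
    refine (h _ (RandomLattice.mul_mem_Icc_of_mem_Icc_div hε ht)).trans
      (RandomLattice.ellTwoNorm_mono fun j => ?_)
    have kp : 0 < k j ω := hc0.trans_le (hkc j).1
    rw [abs_mul, abs_mul, abs_of_pos (one_div_pos.2 hC0), abs_of_pos (one_div_pos.2 kp)]
    exact mul_le_mul_of_nonneg_right (one_div_le_one_div_of_le kp (hkc j).2) (abs_nonneg _)
  · intro hP
    obtain ⟨κ, hκ, low⟩ := RandomLattice.exists_le_ellTwoNorm_sample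
      (Q := RandomLattice.waveP kt mb Φ Ψ) (continuous_const.mul (cA.neg.add cB)) hP
    refine RandomLattice.tendsto_supRelError hκ (f := fun ε t j => p ε t j)
      (g := fun ε t j => RandomLattice.waveP kt mb Φ Ψ (ε * j) (ε * t))
      (fun η hη => (main η hη).mono fun ε h t ht => (h t ht).2) ?_
    filter_upwards [low, self_mem_nhdsWithin] with ε h hε t ht
    exact h _ (RandomLattice.mul_mem_Icc_of_mem_Icc_div hε ht)
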